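/- Let $a,b,c,p,n\in\mathbb R$ with $n\neq1$, $p\neq0$, $b\neq0$, and consider the hyperbolic quasilinear radial wave equation $$u_{tt}=g\,u_{rr}+f,\qquad g=c+bu^p,\quad f=\tfrac{n-1}{r}(c+bu^p)u_r+au^{p-1}u_r^2 \qquad(\ast)$$ for $u(t,r)$, on a non-empty connected open set $\Omega$ of points $(t,r,u)$ with $r>0$ and $u$ in the domain of the powers ($u>0$ for arbitrary real $p$; also $u<0$ if $p$ is an integer, and all $u\in\mathbb R$ if $p$ is a positive integer). An (infinitesimal) point symmetry of $(\ast)$ on $\Omega$ is a smooth vector field $\hat{\rm X}=\tau\partial_t+\xi\partial_r+\eta\partial_u$ on $\Omega$ whose characteristic $P=\eta-\tau u_t-\xi u_r$ satisfies $$D_t^2P-(f_u+u_{rr}g_u)P-(f_{u_r}+u_{rr}g_{u_r})D_rP-g\,D_r^2P=0$$ on all formal solutions of $(\ast)$. Put $$\hat{\rm X}_1=\partial_t,\qquad \hat{\rm X}_2=t\partial_t+r\partial_r,\qquad \hat{\rm X}_3=\tfrac12 pb\,r\partial_r+(bu+pc)\partial_u,$$ $$\hat{\rm X}_4=\big(a+b+(1-p)c\big)r^{3-n}\partial_r+(2-n)r^{2-n}\big((b+(1-p)c)u+pc\big)\partial_u,$$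 $$\hat{\rm X}_5=\tfrac12 pb\,r\ln r\,\partial_r+(1+\ln r)(bu+pc)\partial_u,\qquad \hat{\rm X}_6=t^2\partial_t+tu\,\partial_u,$$ and $\rho=a(n-3)+b\big(n-3-\tfrac12p(n-2)\big)$. In each of the following cases the point symmetries on $\Omega$ are exactly the real linear combinations of the listed vector fields, which are linearly independent on $\Omega$, and the commutators are as listed. In every case $[\hat{\rm X}_1,\hat{\rm X}_2]=\hat{\rm X}_1$, and whenever $\hat{\rm X}_3$ is present $[\hat{\rm X}_1,\hat{\rm X}_3]=[\hat{\rm X}_2,\hat{\rm X}_3]=0$. General case $c\neq0$, $p\neq1$: $\hat{\rm X}_1,\hat{\rm X}_2$ (dimension 2). (i) Case $c=0$: (i.1) $\rho\neq0$, $p\neq-4$: $\hat{\rm X}_1,\hat{\rm X}_2,\hat{\rm X}_3$ (dimension 3). (i.2) $n\neq2$, $\rho=0$, $p\neq-4$: $\hat{\rm X}_1,\hat{\rm X}_2,\hat{\rm X}_3,\hat{\rm X}_4$ (dimension 4), with $[\hat{\rm X}_1,\hat{\rm X}_4]=0$, $[\hat{\rm X}_2,\hat{\rm X}_4]=(2-n)\hat{\rm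 X}_4$, $[\hat{\rm X}_3,\hat{\rm X}_4]=p(1-\tfrac n2)b\,\hat{\rm X}_4$. (i.3) $n=2$, $a+b=0$, $p\neq-4$: $\hat{\rm X}_1,\hat{\rm X}_2,\hat{\rm X}_3,\hat{\rm X}_5$ (dimension 4), with $[\hat{\rm X}_1,\hat{\rm X}_5]=0$, $[\hat{\rm X}_2,\hat{\rm X}_5]=\hat{\rm X}_3$, $[\hat{\rm X}_3,\hat{\rm X}_5]=\tfrac{pb}2\hat{\rm X}_3$. (i.4) $\rho\neq0$, $p=-4$: $\hat{\rm X}_1,\hat{\rm X}_2,\hat{\rm X}_3,\hat{\rm X}_6$ (dimension 4), with $[\hat{\rm X}_1,\hat{\rm X}_6]=2\hat{\rm X}_2+\tfrac1b\hat{\rm X}_3$, $[\hat{\rm X}_2,\hat{\rm X}_6]=\hat{\rm X}_6$, $[\hat{\rm X}_3,\hat{\rm X}_6]=0$. (i.5) $n\neq2$, $\rho=0$, $p=-4$: $\hat{\rm X}_1,\hat{\rm X}_2,\hat{\rm X}_3,\hat{\rm X}_4,\hat{\rm X}_6$ (dimension 5), with the commutators of $\hat{\rm X}_6$ listed in (i.4)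 and $[\hat{\rm X}_1,\hat{\rm X}_4]=[\hat{\rm X}_4,\hat{\rm X}_6]=0$, $[\hat{\rm X}_2,\hat{\rm X}_4]=(2-n)\hat{\rm X}_4$, $[\hat{\rm X}_3,\hat{\rm X}_4]=2(n-2)b\,\hat{\rm X}_4$. (i.6) $n=2$, $a+b=0$, $p=-4$: $\hat{\rm X}_1,\hat{\rm X}_2,\hat{\rm X}_3,\hat{\rm X}_5,\hat{\rm X}_6$ (dimension 5), with the commutators of $\hat{\rm X}_6$ listed in (i.4) and $[\hat{\rm X}_1,\hat{\rm X}_5]=[\hat{\rm X}_5,\hat{\rm X}_6]=0$, $[\hat{\rm X}_2,\hat{\rm X}_5]=\hat{\rm X}_3$, $[\hat{\rm X}_3,\hat{\rm X}_5]=-2b\,\hat{\rm X}_3$. (ii) Case $c\neq0$, $p=1$ (so that $\rho=a(n-3)+b(n-3-\tfrac12(n-2))$): (ii.1) $\rho\neq0$: $\hat{\rm X}_1,\hat{\rm X}_2,\hat{\rm X}_3$ (dimension 3). (ii.2) $n\neq2$, $\rho=0$: $\hat{\rm X}_1,\hat{\rm X}_2,\hat{\rm X}_3,\hat{\rm X}_4$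 (dimension 4), with $[\hat{\rm X}_1,\hat{\rm X}_4]=0$, $[\hat{\rm X}_2,\hat{\rm X}_4]=(2-n)\hat{\rm X}_4$, $[\hat{\rm X}_3,\hat{\rm X}_4]=(1-\tfrac n2)b\,\hat{\rm X}_4$. (ii.3) $n=2$, $a+b=0$: $\hat{\rm X}_1,\hat{\rm X}_2,\hat{\rm X}_3,\hat{\rm X}_5$ (dimension 4), with $[\hat{\rm X}_1,\hat{\rm X}_5]=0$, $[\hat{\rm X}_2,\hat{\rm X}_5]=\hat{\rm X}_3$, $[\hat{\rm X}_3,\hat{\rm X}_5]=\tfrac b2\hat{\rm X}_3$. -/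

import Mathlib

open scoped ContDiff

noncomputable section

namespace RadialWave

/-- The space of points `(t, r, u)`. -/
abbrev Pt : Type := ℝ × ℝ × ℝ

/-- A generator `τ ∂/∂t + ξ ∂/∂r + η ∂/∂u` is the map `(t, r, u) ↦ (τ, ξ, η)`. -/
abbrev Generator : Type := Pt → Pt

/-- Total derivative with respect to `t` along a function `u = U t r`. -/
def Dt (F : ℝ → ℝ → ℝ) : ℝ → ℝ → ℝ := fun t r => deriv (fun s => F s r) t

/-- Total derivative with respect to `r` along a function `u = U t r`. -/
def Dr (F : ℝ → ℝ → ℝ) : ℝ → ℝ → ℝ := fun t r => deriv (fun s => F t s) r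

/-- The residual `u_tt - g(r, u, u_r) u_rr - f(r, u, u_r)` along `u = U t r`. -/
def residual (g f : ℝ → ℝ → ℝ → ℝ) (U : ℝ → ℝ → ℝ) : ℝ → ℝ → ℝ := fun t r =>
  Dt (Dt U) t r - g r (U t r) (Dr U t r) * Dr (Dr U) t r - f r (U t r) (Dr U t r)

/-- The third-order jet of `U` at `(t, r)` is that of a formal solution of
`u_tt = g u_rr + f`: the equation and its first total derivatives hold at `(t, r)`.
As the equation is solved for `u_tt`, every such jet extends to a formal solution. -/
def IsFormalSolutionAt (g f : ℝ → ℝ → ℝ → ℝ) (U : ℝ → ℝ → ℝ) (t r : ℝ) : Prop :=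
  residual g f U t r = 0 ∧ Dt (residual g f U) t r = 0 ∧ Dr (residual g f U) t r = 0

/-- The characteristic `P = η - τ u_t - ξ u_r` of a generator along `u = U t r`. -/
def characteristic (X : Generator) (U : ℝ → ℝ → ℝ) : ℝ → ℝ → ℝ := fun t r =>
  (X (t, r, U t r)).2.2 - (X (t, r, U t r)).1 * Dt U t r - (X (t, r, U t r)).2.1 * Dr U t r

/-- The Fréchet derivative of `u_tt - g u_rr - f` at `u = U t r`, applied to `P`:
`D_t² P - (f_u + u_rr g_u) P - (f_{u_r} + u_rr g_{u_r}) D_r P - g D_r² P`. -/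
def linearization (g f : ℝ → ℝ → ℝ → ℝ) (U P : ℝ → ℝ → ℝ) : ℝ → ℝ → ℝ := fun t r =>
  Dt (Dt P) t r
    - (deriv (fun x => f r x (Dr U t r)) (U t r)
        + Dr (Dr U) t r * deriv (fun x => g r x (Dr U t r)) (U t r)) * P t r
    - (deriv (fun v => f r (U t r) v) (Dr U t r)
        + Dr (Dr U) t r * deriv (fun v => g r (U t r) v) (Dr U t r)) * Dr P t r
    - g r (U t r) (Dr U t r) * Dr (Dr P) t r

/-- `X` is an infinitesimal point symmetry of `u_tt = g(r, u, u_r) u_rr + f(r, u, u_r)` on the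
open set `Ω` of `(t, r, u)`-space: it is smooth on `Ω`, and its characteristic satisfies the
linearized equation on all formal solutions. Only derivatives of `U` up to third order
enter the linearized equation. -/
def IsPointSymmetry (g f : ℝ → ℝ → ℝ → ℝ) (Ω : Set Pt) (X : Generator) : Prop :=
  ContDiffOn ℝ ∞ X Ω ∧
    ∀ U : ℝ → ℝ → ℝ, ContDiff ℝ ∞ (fun q : ℝ × ℝ => U q.1 q.2) →
      ∀ t r : ℝ, (t, r, U t r) ∈ Ω → IsFormalSolutionAt g f U t r →
        linearization g f U (characteristic X U) t r = 0

/-- The point symmetries on `Ω` are exactly the real linear combinations of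
`v 0, …, v (k-1)`, which are linearly independent on `Ω`: they form a `k`-dimensional
space with basis `v`. -/
def IsSymmetryBasis (g f : ℝ → ℝ → ℝ → ℝ) (Ω : Set Pt) {k : ℕ} (v : Fin k → Generator) : Prop :=
  LinearIndependent ℝ (fun i => Ω.domRestrict (v i)) ∧
    ∀ X : Generator, IsPointSymmetry g f Ω X ↔ ∃ κ : Fin k → ℝ, Set.EqOn X (∑ i, κ i • v i) Ω

/-- `[X, Y] = Z` on `Ω`, for the commutator of vector fields. -/
def HasCommutator (Ω : Set Pt) (X Y Z : Generator) : Prop :=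
  Set.EqOn (VectorField.lieBracket ℝ X Y) Z Ω

/-- `g = c + b u^p`. -/
def gCoeff (b c p : ℝ) : ℝ → ℝ → ℝ → ℝ := fun _ u _ => c + b * u ^ p

/-- `f = ((n-1)/r) (c + b u^p) u_r + a u^(p-1) u_r²`. -/
def fCoeff (a b c p n : ℝ) : ℝ → ℝ → ℝ → ℝ := fun r u v =>
  (n - 1) / r * (c + b * u ^ p) * v + a * u ^ (p - 1) * v ^ 2

/-- The values of `u` near which `u^p` and `u^(p-1)` are defined and smooth: `u > 0` for arbitrary
real `p`, also `u < 0` if `p` is an integer, and all real `u` if `p` is a positive integer. -/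
def PowerDomain (p u : ℝ) : Prop :=
  0 < u ∨ (u ≠ 0 ∧ ∃ k : ℤ, p = k) ∨ ∃ k : ℕ, 0 < k ∧ p = k

/-- Time translation. -/
def X1 : Generator := fun _ => (1, 0, 0)

/-- Space-time dilation. -/
def X2 : Generator := fun z => (z.1, z.2.1, 0)

/-- Scaling, or shift-scaling. -/
def X3 (b c p : ℝ) : Generator := fun z => (0, p * b * z.2.1 / 2, b * z.2.2 + p * c)

/-- Non-rigid dilation. -/
def X4 (a b c p n : ℝ) : Generator := fun z =>
  (0, (a + b + (1 - p) * c) * z.2.1 ^ (3 - n),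
    (2 - n) * z.2.1 ^ (2 - n) * ((b + (1 - p) * c) * z.2.2 + p * c))

/-- Logarithmic dilation. -/
def X5 (b c p : ℝ) : Generator := fun z =>
  (0, p * b * z.2.1 * Real.log z.2.1 / 2, (1 + Real.log z.2.1) * (b * z.2.2 + p * c))

/-- Temporal inversion. -/
def X6 : Generator := fun z => (z.1 ^ 2, 0, z.1 * z.2.2)

end RadialWave

end

open RadialWave

/-!
The point symmetries of `u_tt = g u_rr + f` are found by Lie's method, carried out on an arbitrary
connected open set.

*Determining equation.* Along the jet of a formal solution, the third-order derivatives of `u` enter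
the linearized equation for the characteristic only through the derivatives of the wave equation
itself (`linearization_characteristic`). As the remaining jet coordinates `u_t`, `u_r`, `u_tr`,
`u_rr` can be prescribed freely at a point (`exists_smooth₂_with_jet`), `X` is a symmetry if and
only if an expression polynomial in them vanishes identically (`isPointSymmetry_iff`).

*Reduction.* The coefficient of `u_tr` gives `τ = τ(t)` and `ξ = ξ(r)`. The coefficient of `u_rr` is
`2 g (ξ_r - τ_t) = g_u η`; differentiating in `u` shows that `2 (ξ_r - τ_t) = p β` with `β = η_u`
and `b η = β (b u + p c)`, where `β` depends on `(t, r)` only and vanishes if `c ≠ 0` and `p ≠ 1`.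
The other coefficients become linear equations for `β`, `τ`, `ξ`. The result, an equivalent system
for the generator, is `IsReduced`. Factors such as `g` and `u ^ (p - 1)`, which may vanish at some
`u`, are cancelled by differentiating in `u` and by density of `u ≠ 0`.

*Integration.* From the reduced system, `τ_tt` and `r ^ (n - 1) β_r` have zero gradient, hence are
constant on the connected domain, and so are the further constants of integration. This gives
`τ = k₀ + k₁ t + k₂ t ^ 2` with `(p + 4) k₂ = 0`, and `β = K N(r) + B + k₂ t` with
`N' = σ r ^ (1 - n)`.
As `n ≠ 1`, the coefficient of `u_r` determines `ξ` algebraically, and its compatibility with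
`2 (ξ_r - τ_t) = p β` is `ρ K = 0`, where `ρ = a (n - 3) + b (n - 3 - p (n - 2) / 2)`. Thus
`isPointSymmetry_iff_exists` describes the symmetries in all cases at once; the generator that
belongs to `K` is `X4` for `n ≠ 2` and `X5` for `n = 2`, since then `N` is a power and a logarithm.
-/

open scoped Topology

noncomputable section

namespace RadialWave

/-! ### Directional derivatives of smooth functions -/

section DirectionalDerivative

variable {E : Type*} [NormedAddCommGroup E] [NormedSpace ℝ E]

/-- The derivative of `F` in the constant direction `e`, as a function of the point. -/
def pd (e : E) (F : E → ℝ) : E → ℝ := fun z => fderiv ℝ F z e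

theorem contDiffOn_pd {Ω : Set E} (hΩ : IsOpen Ω) {F : E → ℝ} (hF : ContDiffOn ℝ ∞ F Ω) (e : E) :
    ContDiffOn ℝ ∞ (pd e F) Ω :=
  ((contDiffOn_infty_iff_fderiv_of_isOpen hΩ).1 hF).2.clm_apply contDiffOn_const

theorem differentiableAt_of_contDiffOn {Ω : Set E} (hΩ : IsOpen Ω) {F : E → ℝ}
    (hF : ContDiffOn ℝ ∞ F Ω) {z : E} (hz : z ∈ Ω) : DifferentiableAt ℝ F z :=
  (hF.differentiableOn (by simp)).differentiableAt (hΩ.mem_nhds hz)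

theorem pd_comm {Ω : Set E} (hΩ : IsOpen Ω) {F : E → ℝ} (hF : ContDiffOn ℝ ∞ F Ω) (d e : E)
    {z : E} (hz : z ∈ Ω) : pd d (pd e F) z = pd e (pd d F) z := by
  have hF' : ContDiffAt ℝ ∞ F z := hF.contDiffAt (hΩ.mem_nhds hz)
  have hsymm : IsSymmSndFDerivAt ℝ F z := (contDiffAt_infty.1 hF' 2).isSymmSndFDerivAt (by simp)
  have hd : DifferentiableAt ℝ (fderiv ℝ F) z :=
    ((contDiffOn_infty_iff_fderiv_of_isOpen hΩ).1 hF).2.differentiableOn (by simp)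
      |>.differentiableAt (hΩ.mem_nhds hz)
  have key : ∀ d e : E, pd d (pd e F) z = fderiv ℝ (fderiv ℝ F) z d e := by
    intro d e
    have := (hd.hasFDerivAt.clm_apply (hasFDerivAt_const e z)).fderiv
    change fderiv ℝ (fun z => fderiv ℝ F z e) z d = _
    rw [this]
    simp
  rw [key, key, hsymm]

theorem pd_congr {Ω : Set E} (hΩ : IsOpen Ω) {F G : E → ℝ} (h : Set.EqOn F G Ω) (e : E) :
    Set.EqOn (pd e F) (pd e G) Ω := fun z hz => by
  simp only [pd, (h.eventuallyEq_of_mem (hΩ.mem_nhds hz)).fderiv_eq]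

theorem pd_eq_zero {Ω : Set E} (hΩ : IsOpen Ω) {F : E → ℝ} (h : ∀ z ∈ Ω, F z = 0) (e : E) :
    ∀ z ∈ Ω, pd e F z = 0 := fun z hz => by
  rw [pd_congr hΩ (G := fun _ => 0) h e hz]
  simp [pd]

end DirectionalDerivative

/-! ### Second derivatives along a line -/

/-- `A` is twice differentiable at `s`, with first derivative `a₁` and second derivative `a₂`. -/
def HasSecondDeriv (A : ℝ → ℝ) (a₁ a₂ s : ℝ) : Prop :=
  ∃ A' : ℝ → ℝ, (∀ᶠ x in 𝓝 s, HasDerivAt A (A' x) x) ∧ A' s = a₁ ∧ HasDerivAt A' a₂ s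

namespace HasSecondDeriv

variable {A B : ℝ → ℝ} {a₁ a₂ b₁ b₂ s : ℝ}

theorem hasDerivAt (h : HasSecondDeriv A a₁ a₂ s) : HasDerivAt A a₁ s := by
  obtain ⟨A', h1, rfl, -⟩ := h
  exact h1.self_of_nhds

theorem deriv_eq (h : HasSecondDeriv A a₁ a₂ s) : deriv A s = a₁ := h.hasDerivAt.deriv

theorem deriv_deriv_eq (h : HasSecondDeriv A a₁ a₂ s) : deriv (deriv A) s = a₂ := by
  obtain ⟨A', h1, -, h2⟩ := h
  have : deriv A =ᶠ[𝓝 s] A' := h1.mono fun x hx => hx.deriv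
  rw [this.deriv_eq, h2.deriv]

theorem sub (hA : HasSecondDeriv A a₁ a₂ s) (hB : HasSecondDeriv B b₁ b₂ s) :
    HasSecondDeriv (fun x => A x - B x) (a₁ - b₁) (a₂ - b₂) s := by
  obtain ⟨A', hA1, rfl, hA2⟩ := hA
  obtain ⟨B', hB1, rfl, hB2⟩ := hB
  exact ⟨fun x => A' x - B' x, (hA1.and hB1).mono fun x hx => hx.1.sub hx.2, rfl, hA2.sub hB2⟩

theorem mul (hA : HasSecondDeriv A a₁ a₂ s) (hB : HasSecondDeriv B b₁ b₂ s) :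
    HasSecondDeriv (fun x => A x * B x) (a₁ * B s + A s * b₁)
      (a₂ * B s + 2 * a₁ * b₁ + A s * b₂) s := by
  have hA0 := hA.hasDerivAt
  have hB0 := hB.hasDerivAt
  obtain ⟨A', hA1, rfl, hA2⟩ := hA
  obtain ⟨B', hB1, rfl, hB2⟩ := hB
  refine ⟨fun x => A' x * B x + A x * B' x, (hA1.and hB1).mono fun x hx => hx.1.mul hx.2, rfl, ?_⟩
  exact ((hA2.mul hB0).add (hA0.mul hB2)).congr_deriv (by ring)

end HasSecondDeriv

/-- Chain rule to second order along a curve in `(t, r, u)`-space whose velocity is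
`e + x' ∂/∂u`. -/
theorem hasSecondDeriv_comp_curve {Ω : Set Pt} (hΩ : IsOpen Ω) {F : Pt → ℝ}
    (hF : ContDiffOn ℝ ∞ F Ω) {γ : ℝ → Pt} {e : Pt} {x' : ℝ → ℝ} {x'' s : ℝ}
    (hγ : ∀ y, HasDerivAt γ (e + x' y • ((0, 0, 1) : Pt)) y) (hx : HasDerivAt x' x'' s)
    (hs : γ s ∈ Ω) :
    HasSecondDeriv (fun y => F (γ y)) (pd e F (γ s) + x' s * pd (0, 0, 1) F (γ s))
      (pd e (pd e F) (γ s) + 2 * x' s * pd e (pd (0, 0, 1) F) (γ s)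
        + x' s ^ 2 * pd (0, 0, 1) (pd (0, 0, 1) F) (γ s) + x'' * pd (0, 0, 1) F (γ s)) s := by
  have first : ∀ G : Pt → ℝ, ContDiffOn ℝ ∞ G Ω → ∀ y, γ y ∈ Ω →
      HasDerivAt (fun y => G (γ y)) (pd e G (γ y) + x' y * pd (0, 0, 1) G (γ y)) y := by
    intro G hG y hy
    refine ((differentiableAt_of_contDiffOn hΩ hG hy).hasFDerivAt.comp_hasDerivAt y
      (hγ y)).congr_deriv ?_
    simp only [map_add, map_smul, smul_eq_mul, pd]
  have hnear : ∀ᶠ y in 𝓝 s, γ y ∈ Ω := (hγ s).continuousAt.eventually (hΩ.mem_nhds hs)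
  refine ⟨_, hnear.mono fun y hy => first F hF y hy, rfl, ?_⟩
  refine ((first _ (contDiffOn_pd hΩ hF e) s hs).add
    (hx.mul (first _ (contDiffOn_pd hΩ hF (0, 0, 1)) s hs))).congr_deriv ?_
  rw [pd_comm hΩ hF (0, 0, 1) e hs]
  ring

/-! ### Total derivatives of smooth functions of two variables -/

/-- Joint smoothness of a function given in curried form. -/
abbrev Smooth₂ (U : ℝ → ℝ → ℝ) : Prop := ContDiff ℝ ∞ (fun q : ℝ × ℝ => U q.1 q.2)

namespace Smooth₂

variable {U : ℝ → ℝ → ℝ}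

theorem hasDerivAt_left (hU : Smooth₂ U) (t r : ℝ) :
    HasDerivAt (fun s => U s r) (pd (1, 0) (fun q : ℝ × ℝ => U q.1 q.2) (t, r)) t :=
  HasFDerivAt.comp_hasDerivAt (l := fun q : ℝ × ℝ => U q.1 q.2) (f := fun s => (s, r)) t
    ((hU.differentiable (by simp)) (t, r)).hasFDerivAt
    ((hasDerivAt_id t).prodMk (hasDerivAt_const t r))

theorem hasDerivAt_right (hU : Smooth₂ U) (t r : ℝ) :
    HasDerivAt (fun s => U t s) (pd (0, 1) (fun q : ℝ × ℝ => U q.1 q.2) (t, r)) r :=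
  HasFDerivAt.comp_hasDerivAt (l := fun q : ℝ × ℝ => U q.1 q.2) (f := fun s => (t, s)) r
    ((hU.differentiable (by simp)) (t, r)).hasFDerivAt
    ((hasDerivAt_const r t).prodMk (hasDerivAt_id r))

theorem Dt_eq (hU : Smooth₂ U) : Dt U = fun t r => pd (1, 0) (fun q : ℝ × ℝ => U q.1 q.2) (t, r) :=
  funext fun t => funext fun r => (hU.hasDerivAt_left t r).deriv

theorem Dr_eq (hU : Smooth₂ U) : Dr U = fun t r => pd (0, 1) (fun q : ℝ × ℝ => U q.1 q.2) (t, r) :=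
  funext fun t => funext fun r => (hU.hasDerivAt_right t r).deriv

theorem hasDerivAt_Dt (hU : Smooth₂ U) (t r : ℝ) : HasDerivAt (fun s => U s r) (Dt U t r) t :=
  (hU.hasDerivAt_left t r).differentiableAt.hasDerivAt

theorem hasDerivAt_Dr (hU : Smooth₂ U) (t r : ℝ) : HasDerivAt (fun s => U t s) (Dr U t r) r :=
  (hU.hasDerivAt_right t r).differentiableAt.hasDerivAt

theorem Dt (hU : Smooth₂ U) : Smooth₂ (Dt U) := by
  rw [hU.Dt_eq]
  exact contDiffOn_univ.1 (contDiffOn_pd isOpen_univ hU.contDiffOn (1, 0))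

theorem Dr (hU : Smooth₂ U) : Smooth₂ (Dr U) := by
  rw [hU.Dr_eq]
  exact contDiffOn_univ.1 (contDiffOn_pd isOpen_univ hU.contDiffOn (0, 1))

theorem Dr_Dt (hU : Smooth₂ U) :
    RadialWave.Dr (RadialWave.Dt U) = RadialWave.Dt (RadialWave.Dr U) := by
  rw [hU.Dt.Dr_eq, hU.Dr.Dt_eq, hU.Dt_eq, hU.Dr_eq]
  funext t r
  exact pd_comm isOpen_univ hU.contDiffOn (0, 1) (1, 0) (Set.mem_univ _)

theorem hasSecondDeriv_left (hU : Smooth₂ U) (t r : ℝ) :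
    HasSecondDeriv (fun s => U s r) (RadialWave.Dt U t r)
      (RadialWave.Dt (RadialWave.Dt U) t r) t :=
  ⟨fun s => RadialWave.Dt U s r, .of_forall fun s => hU.hasDerivAt_Dt s r, rfl,
    hU.Dt.hasDerivAt_Dt t r⟩

theorem hasSecondDeriv_right (hU : Smooth₂ U) (t r : ℝ) :
    HasSecondDeriv (fun s => U t s) (RadialWave.Dr U t r)
      (RadialWave.Dr (RadialWave.Dr U) t r) r :=
  ⟨fun s => RadialWave.Dr U t s, .of_forall fun s => hU.hasDerivAt_Dr t s, rfl,
    hU.Dr.hasDerivAt_Dr t r⟩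

end Smooth₂

/-! ### Powers on their domain -/

namespace PowerDomain

variable {p u : ℝ}

theorem ne_zero_or (h : PowerDomain p u) : u ≠ 0 ∨ p = 1 ∨ 2 ≤ p := by
  rcases h with h | h | ⟨k, hk, rfl⟩
  · exact .inl h.ne'
  · exact .inl h.1
  · rcases (show k = 1 ∨ 2 ≤ k by omega) with rfl | hk
    · exact .inr (.inl (by simp))
    · exact .inr (.inr (by exact_mod_cast hk))

theorem hasDerivAt_rpow (h : PowerDomain p u) :
    HasDerivAt (fun x : ℝ => x ^ p) (p * u ^ (p - 1)) u := by
  refine Real.hasDerivAt_rpow_const ?_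
  rcases h.ne_zero_or with h | h | h
  · exact .inl h
  · exact .inr h.ge
  · exact .inr (by linarith)

theorem hasDerivAt_rpow_sub_one (h : PowerDomain p u) :
    HasDerivAt (fun x : ℝ => x ^ (p - 1)) ((p - 1) * u ^ (p - 1 - 1)) u := by
  rcases h.ne_zero_or with h | rfl | h
  · exact Real.hasDerivAt_rpow_const (.inl h)
  · simpa using hasDerivAt_const u (1 : ℝ)
  · exact Real.hasDerivAt_rpow_const (.inr (by linarith))

theorem mul_rpow_sub_one (h : PowerDomain p u) : u * u ^ (p - 1) = u ^ p := by
  by_cases hu : u = 0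
  · have hp : p ≠ 0 := by
      rcases h.ne_zero_or with h | h | h
      · exact absurd hu h
      · simp [h]
      · linarith
    simp [hu, Real.zero_rpow hp]
  · rw [Real.rpow_sub_one hu]
    field_simp

theorem mul_rpow_sub_two (p u : ℝ) :
    u * ((p - 1) * u ^ (p - 1 - 1)) = (p - 1) * u ^ (p - 1) := by
  by_cases hu : u = 0
  · by_cases hp : p - 1 = 0
    · simp [hp]
    · simp [hu, Real.zero_rpow hp]
  · rw [Real.rpow_sub_one hu (p - 1)]
    field_simp

end PowerDomain

/-! ### The coefficients of the wave equation -/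

section Coefficients

variable {a b c p n : ℝ} {r u : ℝ}

theorem hasDerivAt_gCoeff (h : PowerDomain p u) (v : ℝ) :
    HasDerivAt (fun x => gCoeff b c p r x v) (b * (p * u ^ (p - 1))) u :=
  (h.hasDerivAt_rpow.const_mul b).const_add c

theorem hasDerivAt_fCoeff_u (h : PowerDomain p u) (v : ℝ) :
    HasDerivAt (fun x => fCoeff a b c p n r x v)
      ((n - 1) / r * (b * (p * u ^ (p - 1))) * v
        + a * ((p - 1) * u ^ (p - 1 - 1)) * v ^ 2) u :=
  ((((h.hasDerivAt_rpow.const_mul b).const_add c).const_mul ((n - 1) / r)).mul_const v).add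
    ((h.hasDerivAt_rpow_sub_one.const_mul a).mul_const (v ^ 2))

theorem hasDerivAt_fCoeff_v (v : ℝ) :
    HasDerivAt (fun x => fCoeff a b c p n r u x)
      ((n - 1) / r * (c + b * u ^ p) + 2 * a * u ^ (p - 1) * v) v :=
  (((hasDerivAt_id v).const_mul ((n - 1) / r * (c + b * u ^ p))).add
    (((hasDerivAt_id v).pow 2).const_mul (a * u ^ (p - 1)))).congr_deriv (by simp; ring)

end Coefficients

/-! ### The linearized equation in jet coordinates -/

/-- The first total derivative in direction `e`, at a point where the derivative of `u` in this
direction is `y`. -/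
def total₁ (e : Pt) (F : Pt → ℝ) (z : Pt) (y : ℝ) : ℝ := pd e F z + y * pd (0, 0, 1) F z

/-- The second total derivative in direction `e`, at a point where the first and second
derivatives of `u` in this direction are `y` and `y₂`. -/
def total₂ (e : Pt) (F : Pt → ℝ) (z : Pt) (y y₂ : ℝ) : ℝ :=
  pd e (pd e F) z + 2 * y * pd e (pd (0, 0, 1) F) z + y ^ 2 * pd (0, 0, 1) (pd (0, 0, 1) F) z
    + y₂ * pd (0, 0, 1) F z

/-- The linearized equation for the characteristic of `τ ∂/∂t + ξ ∂/∂r + η ∂/∂u`, reduced modulo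
the wave equation: a function of the point `z = (t, r, u)` and of the free jet coordinates
`s = u_t`, `v = u_r`, `m = u_tr`, `w = u_rr`. -/
def determining (a b c p n : ℝ) (τ ξ η : Pt → ℝ) (z : Pt) (s v m w : ℝ) : ℝ :=
  let g := gCoeff b c p z.2.1 z.2.2 v
  let gu := b * (p * z.2.2 ^ (p - 1))
  let f := fCoeff a b c p n z.2.1 z.2.2 v
  let fu := (n - 1) / z.2.1 * gu * v + a * ((p - 1) * z.2.2 ^ (p - 1 - 1)) * v ^ 2
  let fv := (n - 1) / z.2.1 * g + 2 * a * z.2.2 ^ (p - 1) * v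
  let fr := -(n - 1) / z.2.1 ^ 2 * g * v
  let q := g * w + f
  total₂ (1, 0, 0) η z s q - s * total₂ (1, 0, 0) τ z s q - 2 * q * total₁ (1, 0, 0) τ z s
    - v * total₂ (1, 0, 0) ξ z s q - 2 * m * total₁ (1, 0, 0) ξ z s
    - g * (total₂ (0, 1, 0) η z v w - s * total₂ (0, 1, 0) τ z v w
        - 2 * m * total₁ (0, 1, 0) τ z v
        - v * total₂ (0, 1, 0) ξ z v w - 2 * w * total₁ (0, 1, 0) ξ z v)
    - (fu + w * gu) * η z
    - fv * (total₁ (0, 1, 0) η z v - s * total₁ (0, 1, 0) τ z v - v * total₁ (0, 1, 0) ξ z v)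
    - ξ z * fr

section Linearization

variable {a b c p n : ℝ} {U : ℝ → ℝ → ℝ} {t r : ℝ}

theorem Dt_residual (hU : Smooth₂ U) (h : PowerDomain p (U t r)) :
    Dt (residual (gCoeff b c p) (fCoeff a b c p n) U) t r =
      Dt (Dt (Dt U)) t r
        - (b * (p * U t r ^ (p - 1)) * Dt U t r * Dr (Dr U) t r
            + (c + b * U t r ^ p) * Dt (Dr (Dr U)) t r)
        - ((n - 1) / r * (b * (p * U t r ^ (p - 1)) * Dt U t r * Dr U t r
              + (c + b * U t r ^ p) * Dt (Dr U) t r)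
            + a * ((p - 1) * U t r ^ (p - 1 - 1) * Dt U t r * Dr U t r ^ 2
              + U t r ^ (p - 1) * (2 * Dr U t r * Dt (Dr U) t r))) := by
  have h0 := hU.hasDerivAt_Dt t r
  have hv := hU.Dr.hasDerivAt_Dt t r
  have hg := ((h.hasDerivAt_rpow.comp t h0).const_mul b).const_add c
  have hh := h.hasDerivAt_rpow_sub_one.comp t h0
  refine ((((hU.Dt.Dt.hasDerivAt_Dt t r).sub (hg.mul (hU.Dr.Dr.hasDerivAt_Dt t r))).sub
    (((hg.const_mul ((n - 1) / r)).mul hv).add ((hh.const_mul a).mul (hv.pow 2)))).congr_deriv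
      ?_).deriv
  simp only [Function.comp, Pi.pow_apply]
  push_cast
  ring

theorem Dr_residual (hU : Smooth₂ U) (h : PowerDomain p (U t r)) (hr : r ≠ 0) :
    Dr (residual (gCoeff b c p) (fCoeff a b c p n) U) t r =
      Dr (Dt (Dt U)) t r
        - (b * (p * U t r ^ (p - 1)) * Dr U t r * Dr (Dr U) t r
            + (c + b * U t r ^ p) * Dr (Dr (Dr U)) t r)
        - (-(n - 1) / r ^ 2 * (c + b * U t r ^ p) * Dr U t r
            + (n - 1) / r * (b * (p * U t r ^ (p - 1)) * Dr U t r * Dr U t r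
              + (c + b * U t r ^ p) * Dr (Dr U) t r)
            + a * ((p - 1) * U t r ^ (p - 1 - 1) * Dr U t r * Dr U t r ^ 2
              + U t r ^ (p - 1) * (2 * Dr U t r * Dr (Dr U) t r))) := by
  have h0 := hU.hasDerivAt_Dr t r
  have hv := hU.Dr.hasDerivAt_Dr t r
  have hg := ((h.hasDerivAt_rpow.comp r h0).const_mul b).const_add c
  have hh := h.hasDerivAt_rpow_sub_one.comp r h0
  have hn : HasDerivAt (fun x => (n - 1) / x) (-(n - 1) / r ^ 2) r := by
    exact ((hasDerivAt_const r (n - 1)).div (hasDerivAt_id r) hr).congr_deriv (by simp)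
  refine ((((hU.Dt.Dt.hasDerivAt_Dr t r).sub (hg.mul (hU.Dr.Dr.hasDerivAt_Dr t r))).sub
    (((hn.mul hg).mul hv).add ((hh.const_mul a).mul (hv.pow 2)))).congr_deriv
      ?_).deriv
  simp only [Function.comp, Pi.pow_apply, Pi.mul_apply]
  push_cast
  ring

/-- On the jet of a formal solution the third-order derivatives of `u` drop out of the linearized
equation, as their coefficients `τ` and `ξ` are those of the derivatives of the wave equation. -/
theorem linearization_characteristic {Ω : Set Pt} (hΩ : IsOpen Ω) {X : Generator}
    (hX : ContDiffOn ℝ ∞ X Ω) (hU : Smooth₂ U) (hz : (t, r, U t r) ∈ Ω) (hr : r ≠ 0)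
    (h : PowerDomain p (U t r))
    (hsol : IsFormalSolutionAt (gCoeff b c p) (fCoeff a b c p n) U t r) :
    linearization (gCoeff b c p) (fCoeff a b c p n) U (characteristic X U) t r =
      determining a b c p n (fun z => (X z).1) (fun z => (X z).2.1) (fun z => (X z).2.2)
        (t, r, U t r) (Dt U t r) (Dr U t r) (Dt (Dr U) t r) (Dr (Dr U) t r) := by
  obtain ⟨e0, e1, e2⟩ := hsol
  rw [Dt_residual hU h] at e1
  rw [Dr_residual hU h hr] at e2
  have hτ : ContDiffOn ℝ ∞ (fun z => (X z).1) Ω := hX.fst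
  have hξ : ContDiffOn ℝ ∞ (fun z => (X z).2.1) Ω := hX.snd.fst
  have hη : ContDiffOn ℝ ∞ (fun z => (X z).2.2) Ω := hX.snd.snd
  have curve_t : ∀ y, HasDerivAt (fun y => ((y, r, U y r) : Pt))
      ((1, 0, 0) + Dt U y r • ((0, 0, 1) : Pt)) y := fun y => by
    refine ((hasDerivAt_id y).prodMk
      ((hasDerivAt_const y r).prodMk (hU.hasDerivAt_Dt y r))).congr_deriv ?_
    simp
  have curve_r : ∀ y, HasDerivAt (fun y => ((t, y, U t y) : Pt))
      ((0, 1, 0) + Dr U t y • ((0, 0, 1) : Pt)) y := fun y => by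
    refine ((hasDerivAt_const y t).prodMk
      ((hasDerivAt_id y).prodMk (hU.hasDerivAt_Dr t y))).congr_deriv ?_
    simp
  have chain_t := fun (F : Pt → ℝ) (hF : ContDiffOn ℝ ∞ F Ω) =>
    hasSecondDeriv_comp_curve hΩ hF curve_t (hU.Dt.hasDerivAt_Dt t r) hz
  have chain_r := fun (F : Pt → ℝ) (hF : ContDiffOn ℝ ∞ F Ω) =>
    hasSecondDeriv_comp_curve hΩ hF curve_r (hU.Dr.hasDerivAt_Dr t r) hz
  have Pt2 := ((chain_t _ hη).sub ((chain_t _ hτ).mul (hU.Dt.hasSecondDeriv_left t r))).sub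
    ((chain_t _ hξ).mul (hU.Dr.hasSecondDeriv_left t r))
  have Pr2 := ((chain_r _ hη).sub ((chain_r _ hτ).mul (hU.Dt.hasSecondDeriv_right t r))).sub
    ((chain_r _ hξ).mul (hU.Dr.hasSecondDeriv_right t r))
  have d1 : Dt (Dt (characteristic X U)) t r = _ := Pt2.deriv_deriv_eq
  have d2 : Dr (Dr (characteristic X U)) t r = _ := Pr2.deriv_deriv_eq
  have d3 : Dr (characteristic X U) t r = _ := Pr2.deriv_eq
  have c1 : Dr (Dt U) = Dt (Dr U) := hU.Dr_Dt
  have c2 : Dr (Dt (Dt U)) = Dt (Dt (Dr U)) := by rw [hU.Dt.Dr_Dt, c1]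
  rw [c2] at e2
  rw [linearization, d1, d2, d3, (hasDerivAt_gCoeff h _).deriv, (hasDerivAt_fCoeff_u h _).deriv,
    (hasDerivAt_fCoeff_v _).deriv, show deriv (fun v => gCoeff b c p r (U t r) v) (Dr U t r) = 0
      from deriv_const _ _, c1, hU.Dr.Dr_Dt]
  simp only [determining, total₁, total₂, characteristic, gCoeff, fCoeff, residual] at e0 ⊢
  have e0' : Dt (Dt U) t r = (c + b * U t r ^ p) * Dr (Dr U) t r
      + ((n - 1) / r * (c + b * U t r ^ p) * Dr U t r + a * U t r ^ (p - 1) * Dr U t r ^ 2) := by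
    linarith
  rw [e0']
  linear_combination (-(X (t, r, U t r)).1) * e1 - (X (t, r, U t r)).2.1 * e2

end Linearization

/-- A cubic polynomial realizes any prescribed jet at `(t, r)`; taking `u_trr = u_rrr = 0` leaves
`u_ttt = A` and `u_ttr = B` free to be adjusted to the derivatives of the wave equation. -/
theorem exists_smooth₂_with_jet (t r u s v q m w A B : ℝ) :
    ∃ U : ℝ → ℝ → ℝ, Smooth₂ U ∧ U t r = u ∧ Dt U t r = s ∧ Dr U t r = v ∧ Dt (Dt U) t r = q ∧
      Dt (Dr U) t r = m ∧ Dr (Dr U) t r = w ∧ Dt (Dt (Dt U)) t r = A ∧ Dr (Dt (Dt U)) t r = B ∧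
      Dt (Dr (Dr U)) t r = 0 ∧ Dr (Dr (Dr U)) t r = 0 := by
  set U : ℝ → ℝ → ℝ := fun x y => u + s * (x - t) + v * (y - r) + q / 2 * (x - t) ^ 2
    + m * ((x - t) * (y - r)) + w / 2 * (y - r) ^ 2 + A / 6 * (x - t) ^ 3
    + B / 2 * ((x - t) ^ 2 * (y - r)) with hU
  have ht : Dt U = fun x y => s + q * (x - t) + m * (y - r) + A / 2 * (x - t) ^ 2
      + B * ((x - t) * (y - r)) := by
    funext x y
    have h := (hasDerivAt_id x).sub_const t
    exact ((((((((h.const_mul s).const_add u).add_const (v * (y - r))).add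
      ((h.pow 2).const_mul (q / 2))).add ((h.mul_const (y - r)).const_mul m)).add_const
      (w / 2 * (y - r) ^ 2)).add ((h.pow 3).const_mul (A / 6))).add
      (((h.pow 2).mul_const (y - r)).const_mul (B / 2))).congr_deriv (by simp; ring) |>.deriv
  have hr : Dr U = fun x y => v + m * (x - t) + w * (y - r) + B / 2 * (x - t) ^ 2 := by
    funext x y
    have h := (hasDerivAt_id y).sub_const r
    exact (((((((h.const_mul v).const_add (u + s * (x - t))).add_const (q / 2 * (x - t) ^ 2)).add
      ((h.const_mul (x - t)).const_mul m)).add ((h.pow 2).const_mul (w / 2))).add_const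
      (A / 6 * (x - t) ^ 3)).add ((h.const_mul ((x - t) ^ 2)).const_mul (B / 2))).congr_deriv
      (by simp; ring) |>.deriv
  have htt : Dt (Dt U) = fun x y => q + A * (x - t) + B * (y - r) := by
    rw [ht]
    funext x y
    have h := (hasDerivAt_id x).sub_const t
    exact (((((h.const_mul q).const_add s).add_const (m * (y - r))).add
      ((h.pow 2).const_mul (A / 2))).add ((h.mul_const (y - r)).const_mul B)).congr_deriv
      (by simp; ring) |>.deriv
  have htr : Dt (Dr U) = fun x y => m + B * (x - t) := by
    rw [hr]
    funext x y
    have h := (hasDerivAt_id x).sub_const t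
    exact ((((h.const_mul m).const_add v).add_const (w * (y - r))).add
      ((h.pow 2).const_mul (B / 2))).congr_deriv (by simp; ring) |>.deriv
  have hrr : Dr (Dr U) = fun x y => w := by
    rw [hr]
    funext x y
    have h := (hasDerivAt_id y).sub_const r
    exact (((h.const_mul w).const_add (v + m * (x - t))).add_const
      (B / 2 * (x - t) ^ 2)).congr_deriv (by simp) |>.deriv
  have httt : Dt (Dt (Dt U)) t r = A := by
    rw [htt]
    have h := (hasDerivAt_id t).sub_const t
    exact (((h.const_mul A).const_add q).add_const (B * (r - r))).congr_deriv (by simp) |>.deriv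
  have hrtt : Dr (Dt (Dt U)) t r = B := by
    rw [htt]
    have h := (hasDerivAt_id r).sub_const r
    exact ((h.const_mul B).const_add (q + A * (t - t))).congr_deriv (by simp) |>.deriv
  refine ⟨U, ?_, by simp [hU], by simp [ht], by simp [hr], by simp [htt], by simp [htr],
    by simp [hrr], httt, hrtt, by simp [hrr, Dt], by rw [hrr]; simp [Dr]⟩
  simp only [hU, Smooth₂]
  fun_prop

/-- A smooth vector field is a point symmetry exactly when it satisfies the determining equation
for all values of the free jet coordinates. -/
theorem isPointSymmetry_iff {a b c p n : ℝ} {Ω : Set Pt} (hΩ : IsOpen Ω)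
    (hdom : ∀ t r u : ℝ, (t, r, u) ∈ Ω → 0 < r ∧ PowerDomain p u) (X : Generator) :
    IsPointSymmetry (gCoeff b c p) (fCoeff a b c p n) Ω X ↔
      ContDiffOn ℝ ∞ X Ω ∧ ∀ z ∈ Ω, ∀ s v m w, determining a b c p n (fun z => (X z).1)
        (fun z => (X z).2.1) (fun z => (X z).2.2) z s v m w = 0 := by
  refine and_congr_right fun hX => ⟨fun h => ?_, fun h U hU t r hz hsol => ?_⟩
  · rintro ⟨t, r, u⟩ hz s v m w
    obtain ⟨hr, hu⟩ := hdom t r u hz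
    obtain ⟨U, hU, hUu, hUs, hUv, hUq, hUm, hUw, hUA, hUB, hUtrr, hUrrr⟩ :=
      exists_smooth₂_with_jet t r u s v
        ((c + b * u ^ p) * w + ((n - 1) / r * (c + b * u ^ p) * v + a * u ^ (p - 1) * v ^ 2)) m w
        (b * (p * u ^ (p - 1)) * s * w
          + ((n - 1) / r * (b * (p * u ^ (p - 1)) * s * v + (c + b * u ^ p) * m)
            + a * ((p - 1) * u ^ (p - 1 - 1) * s * v ^ 2 + u ^ (p - 1) * (2 * v * m))))
        (b * (p * u ^ (p - 1)) * v * w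
          + (-(n - 1) / r ^ 2 * (c + b * u ^ p) * v
            + (n - 1) / r * (b * (p * u ^ (p - 1)) * v * v + (c + b * u ^ p) * w)
            + a * ((p - 1) * u ^ (p - 1 - 1) * v * v ^ 2 + u ^ (p - 1) * (2 * v * w))))
    subst hUu
    have hsol : IsFormalSolutionAt (gCoeff b c p) (fCoeff a b c p n) U t r := by
      refine ⟨?_, ?_, ?_⟩
      · simp only [residual, gCoeff, fCoeff, hUq, hUv, hUw]
        ring
      · rw [Dt_residual hU hu, hUs, hUv, hUw, hUA, hUtrr, hUm]
        ring
      · rw [Dr_residual hU hu hr.ne', hUv, hUw, hUB, hUrrr]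
        ring
    have := h U hU t r hz hsol
    rwa [linearization_characteristic hΩ hX hU hz hr.ne' hu hsol, hUs, hUv, hUm, hUw] at this
  · obtain ⟨hr, hu⟩ := hdom t r _ hz
    rw [linearization_characteristic hΩ hX hU hz hr.ne' hu hsol]
    exact h _ hz _ _ _ _

/-! ### Partial derivatives as derivatives along coordinate lines -/

section CoordinateLines

variable {F : Pt → ℝ} {z : Pt}

theorem hasDerivAt_line_t (hF : DifferentiableAt ℝ F z) :
    HasDerivAt (fun s => F (s, z.2.1, z.2.2)) (pd (1, 0, 0) F z) z.1 :=
  HasFDerivAt.comp_hasDerivAt (f := fun s => ((s, z.2.1, z.2.2) : Pt)) z.1 hF.hasFDerivAt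
    ((hasDerivAt_id _).prodMk ((hasDerivAt_const _ _).prodMk (hasDerivAt_const _ _)))

theorem hasDerivAt_line_r (hF : DifferentiableAt ℝ F z) :
    HasDerivAt (fun s => F (z.1, s, z.2.2)) (pd (0, 1, 0) F z) z.2.1 :=
  HasFDerivAt.comp_hasDerivAt (f := fun s => ((z.1, s, z.2.2) : Pt)) z.2.1 hF.hasFDerivAt
    ((hasDerivAt_const _ _).prodMk ((hasDerivAt_id _).prodMk (hasDerivAt_const _ _)))

theorem hasDerivAt_line_u (hF : DifferentiableAt ℝ F z) :
    HasDerivAt (fun s => F (z.1, z.2.1, s)) (pd (0, 0, 1) F z) z.2.2 :=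
  HasFDerivAt.comp_hasDerivAt (f := fun s => ((z.1, z.2.1, s) : Pt)) z.2.2 hF.hasFDerivAt
    ((hasDerivAt_const _ _).prodMk ((hasDerivAt_const _ _).prodMk (hasDerivAt_id _)))

variable {Ω : Set Pt} {a : ℝ}

theorem eventually_line_t (hΩ : IsOpen Ω) (hz : z ∈ Ω) :
    ∀ᶠ s in 𝓝 z.1, ((s, z.2.1, z.2.2) : Pt) ∈ Ω :=
  (by fun_prop : Continuous fun s : ℝ => ((s, z.2.1, z.2.2) : Pt)).continuousAt.eventually
    (hΩ.mem_nhds hz)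

theorem eventually_line_r (hΩ : IsOpen Ω) (hz : z ∈ Ω) :
    ∀ᶠ s in 𝓝 z.2.1, ((z.1, s, z.2.2) : Pt) ∈ Ω :=
  (by fun_prop : Continuous fun s : ℝ => ((z.1, s, z.2.2) : Pt)).continuousAt.eventually
    (hΩ.mem_nhds hz)

theorem eventually_line_u (hΩ : IsOpen Ω) (hz : z ∈ Ω) :
    ∀ᶠ s in 𝓝 z.2.2, ((z.1, z.2.1, s) : Pt) ∈ Ω :=
  (by fun_prop : Continuous fun s : ℝ => ((z.1, z.2.1, s) : Pt)).continuousAt.eventually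
    (hΩ.mem_nhds hz)

theorem line_t_eq_zero (hΩ : IsOpen Ω) (hF : ∀ z ∈ Ω, F z = 0) (hz : z ∈ Ω)
    (h : HasDerivAt (fun s => F (s, z.2.1, z.2.2)) a z.1) : a = 0 :=
  h.unique ((hasDerivAt_const z.1 (0 : ℝ)).congr_of_eventuallyEq
    ((eventually_line_t hΩ hz).mono fun _ hs => hF _ hs))

theorem line_r_eq_zero (hΩ : IsOpen Ω) (hF : ∀ z ∈ Ω, F z = 0) (hz : z ∈ Ω)
    (h : HasDerivAt (fun s => F (z.1, s, z.2.2)) a z.2.1) : a = 0 :=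
  h.unique ((hasDerivAt_const z.2.1 (0 : ℝ)).congr_of_eventuallyEq
    ((eventually_line_r hΩ hz).mono fun _ hs => hF _ hs))

theorem line_u_eq_zero (hΩ : IsOpen Ω) (hF : ∀ z ∈ Ω, F z = 0) (hz : z ∈ Ω)
    (h : HasDerivAt (fun s => F (z.1, z.2.1, s)) a z.2.2) : a = 0 :=
  h.unique ((hasDerivAt_const z.2.2 (0 : ℝ)).congr_of_eventuallyEq
    ((eventually_line_u hΩ hz).mono fun _ hs => hF _ hs))

/-- A function on a connected open set whose three partial derivatives vanish is constant. -/
theorem exists_eq_const (hΩ : IsOpen Ω) (hconn : IsConnected Ω)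
    (hF : ∀ z ∈ Ω, DifferentiableAt ℝ F z)
    (ht : ∀ z ∈ Ω, HasDerivAt (fun s => F (s, z.2.1, z.2.2)) 0 z.1)
    (hr : ∀ z ∈ Ω, HasDerivAt (fun s => F (z.1, s, z.2.2)) 0 z.2.1)
    (hu : ∀ z ∈ Ω, HasDerivAt (fun s => F (z.1, z.2.1, s)) 0 z.2.2) :
    ∃ k, ∀ z ∈ Ω, F z = k := by
  refine hΩ.exists_is_const_of_fderiv_eq_zero (𝕜 := ℝ) hconn.isPreconnected
    (fun z hz => (hF z hz).differentiableWithinAt) fun z hz => ?_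
  have e1 : fderiv ℝ F z (1, 0) = 0 := (hasDerivAt_line_t (hF z hz)).unique (ht z hz)
  have e2 : fderiv ℝ F z (0, 1, 0) = 0 := (hasDerivAt_line_r (hF z hz)).unique (hr z hz)
  have e3 : fderiv ℝ F z (0, 0, 1) = 0 := (hasDerivAt_line_u (hF z hz)).unique (hu z hz)
  ext <;> simp [e1, e2, e3]

end CoordinateLines

/-! ### Cancelling factors that depend on `u` only -/

section Cancellation

variable {Ω : Set Pt} {F : Pt → ℝ} {p : ℝ}

theorem PowerDomain.rpow_sub_one_ne_zero {u : ℝ} (h : PowerDomain p u) (hu : u ≠ 0) :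
    u ^ (p - 1) ≠ 0 := by
  have key : ∀ k : ℤ, u ^ ((k : ℝ) - 1) ≠ 0 := fun k => by
    rw [Real.rpow_sub_one hu, Real.rpow_intCast]
    exact div_ne_zero (zpow_ne_zero k hu) hu
  rcases h with h | ⟨-, k, rfl⟩ | ⟨k, -, rfl⟩
  · exact (Real.rpow_pos_of_pos h _).ne'
  · exact key k
  · exact key k

/-- The power `u ^ (p - 1)` is nonzero on a dense set, hence can be cancelled. -/
theorem eq_zero_of_rpow_mul (hΩ : IsOpen Ω) (hdom : ∀ z ∈ Ω, PowerDomain p z.2.2)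
    (hF : ∀ z ∈ Ω, ContinuousAt F z) (h : ∀ z ∈ Ω, z.2.2 ^ (p - 1) * F z = 0) :
    ∀ z ∈ Ω, F z = 0 := by
  intro z hz
  by_contra hne
  have hcont : ContinuousAt (fun s : ℝ => F (z.1, z.2.1, s)) z.2.2 :=
    ContinuousAt.comp (g := F) (f := fun s : ℝ => ((z.1, z.2.1, s) : Pt)) (hF z hz)
      (by fun_prop : Continuous fun s : ℝ => ((z.1, z.2.1, s) : Pt)).continuousAt
  have h1 : ∀ᶠ s in 𝓝[≠] z.2.2, F (z.1, z.2.1, s) ≠ 0 ∧ ((z.1, z.2.1, s) : Pt) ∈ Ω :=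
    ((hcont.eventually_ne hne).and (eventually_line_u hΩ hz)).filter_mono nhdsWithin_le_nhds
  have h2 : ∀ᶠ s in 𝓝[≠] z.2.2, s ≠ 0 := by
    by_cases hu : z.2.2 = 0
    · rw [hu]
      exact eventually_mem_nhdsWithin
    · exact (continuousAt_id.eventually_ne hu).filter_mono nhdsWithin_le_nhds
  obtain ⟨s, ⟨hFs, hs⟩, hs0⟩ := (h1.and h2).exists
  exact mul_ne_zero ((hdom _ hs).rpow_sub_one_ne_zero hs0) hFs (h _ hs)

/-- Differentiating `φ F = 0` in `u` and multiplying by `F` gives `φ' F ^ 2 = 0`. -/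
theorem deriv_mul_eq_zero (hΩ : IsOpen Ω) {φ φ' : ℝ → ℝ}
    (hφ : ∀ z ∈ Ω, HasDerivAt φ (φ' z.2.2) z.2.2) (hF : ∀ z ∈ Ω, DifferentiableAt ℝ F z)
    (h : ∀ z ∈ Ω, φ z.2.2 * F z = 0) : ∀ z ∈ Ω, φ' z.2.2 * F z = 0 := by
  intro z hz
  have h1 := line_u_eq_zero (F := fun z => φ z.2.2 * F z) hΩ h hz
    ((hφ z hz).mul (hasDerivAt_line_u (hF z hz)))
  have h2 : φ' z.2.2 * F z ^ 2 = 0 := by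
    linear_combination F z * h1 - pd (0, 0, 1) F z * h z hz
  rcases mul_eq_zero.1 h2 with h3 | h3
  · simp [h3]
  · simp [pow_eq_zero_iff] at h3
    simp [h3]

theorem eq_zero_of_g_mul {b c : ℝ} (hp : p ≠ 0) (hb : b ≠ 0) (hΩ : IsOpen Ω)
    (hdom : ∀ z ∈ Ω, PowerDomain p z.2.2) (hF : ∀ z ∈ Ω, DifferentiableAt ℝ F z)
    (h : ∀ z ∈ Ω, (c + b * z.2.2 ^ p) * F z = 0) : ∀ z ∈ Ω, F z = 0 := by
  have h1 := deriv_mul_eq_zero (φ := fun u => c + b * u ^ p)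
    (φ' := fun u => b * (p * u ^ (p - 1))) hΩ
    (fun z hz => ((hdom z hz).hasDerivAt_rpow.const_mul b).const_add c) hF h
  refine eq_zero_of_rpow_mul hΩ hdom (fun z hz => (hF z hz).continuousAt) fun z hz => ?_
  have := h1 z hz
  have h2 : (b * p) * (z.2.2 ^ (p - 1) * F z) = 0 := by linear_combination this
  exact (mul_eq_zero.1 h2).resolve_left (mul_ne_zero hb hp)

end Cancellation

/-! ### Reduction of the determining equation -/

/-- The determining equations for `τ ∂/∂t + ξ ∂/∂r + η ∂/∂u` in solved form: `τ` is a function of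
`t`, `ξ` one of `r`, and `η = β (u + p c / b)` with `β = η_u` a function of `(t, r)`. -/
structure IsReduced (a b c p n : ℝ) (Ω : Set Pt) (τ ξ η : Pt → ℝ) : Prop where
  tau_r : ∀ z ∈ Ω, pd (0, 1, 0) τ z = 0
  tau_u : ∀ z ∈ Ω, pd (0, 0, 1) τ z = 0
  xi_t : ∀ z ∈ Ω, pd (1, 0, 0) ξ z = 0
  xi_u : ∀ z ∈ Ω, pd (0, 0, 1) ξ z = 0
  eta_uu : ∀ z ∈ Ω, pd (0, 0, 1) (pd (0, 0, 1) η) z = 0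
  eta_eq : ∀ z ∈ Ω, b * η z = pd (0, 0, 1) η z * (b * z.2.2 + p * c)
  scaling : ∀ z ∈ Ω, 2 * (pd (0, 1, 0) ξ z - pd (1, 0, 0) τ z) = p * pd (0, 0, 1) η z
  eta_tu : ∀ z ∈ Ω, 2 * pd (1, 0, 0) (pd (0, 0, 1) η) z = pd (1, 0, 0) (pd (1, 0, 0) τ) z
  eta_ttu : ∀ z ∈ Ω, pd (1, 0, 0) (pd (1, 0, 0) (pd (0, 0, 1) η)) z = 0
  eta_rru : ∀ z ∈ Ω, z.2.1 * pd (0, 1, 0) (pd (0, 1, 0) (pd (0, 0, 1) η)) z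
    + (n - 1) * pd (0, 1, 0) (pd (0, 0, 1) η) z = 0
  xi_eq : ∀ z ∈ Ω, z.2.1 ^ 2 * (b * p / 2 - 2 * b - 2 * a) * pd (0, 1, 0) (pd (0, 0, 1) η) z
    = b * (n - 1) * (z.2.1 * pd (0, 1, 0) ξ z - ξ z)
  generic : c ≠ 0 → p ≠ 1 → ∀ z ∈ Ω, pd (0, 0, 1) η z = 0

section Reduction

variable {a b c p n : ℝ} {Ω : Set Pt} {τ ξ η : Pt → ℝ}

/-- The determining equation when `τ` depends on `t` only and `ξ` on `r` only. -/
theorem determining_eq (hΩ : IsOpen Ω)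
    (hτr : ∀ z ∈ Ω, pd (0, 1, 0) τ z = 0) (hτu : ∀ z ∈ Ω, pd (0, 0, 1) τ z = 0)
    (hξt : ∀ z ∈ Ω, pd (1, 0, 0) ξ z = 0) (hξu : ∀ z ∈ Ω, pd (0, 0, 1) ξ z = 0)
    {z : Pt} (hz : z ∈ Ω) (s v m w : ℝ) :
    determining a b c p n τ ξ η z s v m w =
      (pd (1, 0, 0) (pd (1, 0, 0) η) z + 2 * s * pd (1, 0, 0) (pd (0, 0, 1) η) z
        + s ^ 2 * pd (0, 0, 1) (pd (0, 0, 1) η) z - s * pd (1, 0, 0) (pd (1, 0, 0) τ) z)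
      + (pd (0, 0, 1) η z - 2 * pd (1, 0, 0) τ z) * ((c + b * z.2.2 ^ p) * w
        + ((n - 1) / z.2.1 * (c + b * z.2.2 ^ p) * v + a * z.2.2 ^ (p - 1) * v ^ 2))
      - (c + b * z.2.2 ^ p) * (pd (0, 1, 0) (pd (0, 1, 0) η) z
        + 2 * v * pd (0, 1, 0) (pd (0, 0, 1) η) z + v ^ 2 * pd (0, 0, 1) (pd (0, 0, 1) η) z
        + w * pd (0, 0, 1) η z - v * pd (0, 1, 0) (pd (0, 1, 0) ξ) z - 2 * w * pd (0, 1, 0) ξ z)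
      - ((n - 1) / z.2.1 * (b * (p * z.2.2 ^ (p - 1))) * v
        + a * ((p - 1) * z.2.2 ^ (p - 1 - 1)) * v ^ 2 + w * (b * (p * z.2.2 ^ (p - 1)))) * η z
      - ((n - 1) / z.2.1 * (c + b * z.2.2 ^ p) + 2 * a * z.2.2 ^ (p - 1) * v)
        * (pd (0, 1, 0) η z + v * pd (0, 0, 1) η z - v * pd (0, 1, 0) ξ z)
      + ξ z * ((n - 1) / z.2.1 ^ 2 * (c + b * z.2.2 ^ p) * v) := by
  simp only [determining, total₁, total₂, gCoeff, fCoeff, hτr z hz, hτu z hz, hξt z hz, hξu z hz,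
    pd_eq_zero hΩ hτr _ z hz, pd_eq_zero hΩ hτu _ z hz, pd_eq_zero hΩ hξt _ z hz,
    pd_eq_zero hΩ hξu _ z hz]
  ring

/-- The relation `b F = G (b u + p c)` can be differentiated in `t` and `r`. -/
theorem pd_mul_shift (hΩ : IsOpen Ω) {F G : Pt → ℝ} (hF : ContDiffOn ℝ ∞ F Ω)
    (hG : ContDiffOn ℝ ∞ G Ω) (h : ∀ z ∈ Ω, b * F z = G z * (b * z.2.2 + p * c)) {e : Pt}
    (he : e.2.2 = 0) : ∀ z ∈ Ω, b * pd e F z = pd e G z * (b * z.2.2 + p * c) := by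
  intro z hz
  have h1 := (differentiableAt_of_contDiffOn hΩ hF hz).hasFDerivAt.const_mul b
  have hu : HasFDerivAt (fun z : Pt => b * z.2.2 + p * c)
      (b • (ContinuousLinearMap.snd ℝ ℝ ℝ).comp (ContinuousLinearMap.snd ℝ ℝ (ℝ × ℝ))) z :=
    ((((ContinuousLinearMap.snd ℝ ℝ ℝ).comp
      (ContinuousLinearMap.snd ℝ ℝ (ℝ × ℝ))).hasFDerivAt (x := z)).const_mul b).add_const (p * c)
  have h2 := (differentiableAt_of_contDiffOn hΩ hG hz).hasFDerivAt.mul hu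
  have h3 := (h1.congr_of_eventuallyEq (Filter.eventuallyEq_of_mem (hΩ.mem_nhds hz)
    fun y hy => (h y hy).symm)).unique h2
  have h4 := congrArg (fun L : Pt →L[ℝ] ℝ => L e) h3
  simp [he] at h4
  simp only [pd]
  linear_combination h4

/-- The coefficient of `u_tr` in the determining equation makes `τ` a function of `t` and `ξ` a
function of `r`. -/
theorem tau_xi_of_determining (hp : p ≠ 0) (hb : b ≠ 0) (hΩ : IsOpen Ω)
    (hdom : ∀ z ∈ Ω, PowerDomain p z.2.2) (hτ : ContDiffOn ℝ ∞ τ Ω) (hξ : ContDiffOn ℝ ∞ ξ Ω)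
    (h : ∀ z ∈ Ω, ∀ s v m w, determining a b c p n τ ξ η z s v m w = 0) :
    (∀ z ∈ Ω, pd (0, 1, 0) τ z = 0) ∧ (∀ z ∈ Ω, pd (0, 0, 1) τ z = 0) ∧
      (∀ z ∈ Ω, pd (1, 0, 0) ξ z = 0) ∧ ∀ z ∈ Ω, pd (0, 0, 1) ξ z = 0 := by
  have coef : ∀ z ∈ Ω, ∀ s v : ℝ, (c + b * z.2.2 ^ p) * (pd (0, 1, 0) τ z + v * pd (0, 0, 1) τ z)
      - (pd (1, 0, 0) ξ z + s * pd (0, 0, 1) ξ z) = 0 := by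
    intro z hz s v
    have h0 := h z hz s v 0 0
    have h1 := h z hz s v 1 0
    simp only [determining, total₁, gCoeff] at h0 h1
    linear_combination (h1 - h0) / 2
  have hξu : ∀ z ∈ Ω, pd (0, 0, 1) ξ z = 0 := fun z hz => by
    linear_combination coef z hz 0 0 - coef z hz 1 0
  have hτu : ∀ z ∈ Ω, pd (0, 0, 1) τ z = 0 :=
    eq_zero_of_g_mul (c := c) hp hb hΩ hdom
      (fun z hz => differentiableAt_of_contDiffOn hΩ (contDiffOn_pd hΩ hτ _) hz) fun z hz => by
        linear_combination coef z hz 0 1 - coef z hz 0 0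
  -- `ξ_t = g τ_r`, where `ξ_t` and `τ_r` do not depend on `u`.
  have hτr : ∀ z ∈ Ω, pd (0, 1, 0) τ z = 0 := by
    refine eq_zero_of_rpow_mul hΩ hdom (fun z hz =>
      (differentiableAt_of_contDiffOn hΩ (contDiffOn_pd hΩ hτ _) hz).continuousAt) fun z hz => ?_
    have hd1 := hasDerivAt_line_u
      (differentiableAt_of_contDiffOn hΩ (contDiffOn_pd hΩ hτ (0, 1, 0)) hz)
    have hd2 := hasDerivAt_line_u
      (differentiableAt_of_contDiffOn hΩ (contDiffOn_pd hΩ hξ (1, 0, 0)) hz)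
    rw [pd_comm hΩ hτ _ _ hz, pd_eq_zero hΩ hτu _ z hz] at hd1
    rw [pd_comm hΩ hξ _ _ hz, pd_eq_zero hΩ hξu _ z hz] at hd2
    have key := line_u_eq_zero
      (F := fun z => (c + b * z.2.2 ^ p) * pd (0, 1, 0) τ z - pd (1, 0, 0) ξ z) hΩ
      (fun z hz => by linear_combination coef z hz 0 0) hz
      (((((hdom z hz).hasDerivAt_rpow.const_mul b).const_add c).mul hd1).sub hd2)
    have h2 : (b * p) * (z.2.2 ^ (p - 1) * pd (0, 1, 0) τ z) = 0 := by linear_combination key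
    exact (mul_eq_zero.1 h2).resolve_left (mul_ne_zero hb hp)
  refine ⟨hτr, hτu, fun z hz => ?_, hξu⟩
  linear_combination (c + b * z.2.2 ^ p) * hτr z hz - coef z hz 0 0

/-- The `r`-derivative of the relation `2 (ξ_r - τ_t) = p η_u`, when `τ` does not depend on `r`. -/
theorem scaling_r (hΩ : IsOpen Ω) (hτ : ContDiffOn ℝ ∞ τ Ω)
    (hξ : ContDiffOn ℝ ∞ ξ Ω) (hη : ContDiffOn ℝ ∞ η Ω) (hτr : ∀ z ∈ Ω, pd (0, 1, 0) τ z = 0)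
    (h : ∀ z ∈ Ω, 2 * (pd (0, 1, 0) ξ z - pd (1, 0, 0) τ z) = p * pd (0, 0, 1) η z)
    {z : Pt} (hz : z ∈ Ω) :
    2 * pd (0, 1, 0) (pd (0, 1, 0) ξ) z = p * pd (0, 1, 0) (pd (0, 0, 1) η) z := by
  have l1 := hasDerivAt_line_r (differentiableAt_of_contDiffOn hΩ
    (contDiffOn_pd hΩ hτ (1, 0, 0)) hz)
  rw [pd_comm hΩ hτ _ _ hz, pd_eq_zero hΩ hτr _ z hz] at l1
  have l2 := hasDerivAt_line_r (differentiableAt_of_contDiffOn hΩ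
    (contDiffOn_pd hΩ hξ (0, 1, 0)) hz)
  have l3 := hasDerivAt_line_r (differentiableAt_of_contDiffOn hΩ
    (contDiffOn_pd hΩ hη (0, 0, 1)) hz)
  have key := line_r_eq_zero (F := fun z => 2 * (pd (0, 1, 0) ξ z - pd (1, 0, 0) τ z)
    - p * pd (0, 0, 1) η z) hΩ (fun z hz => sub_eq_zero.2 (h z hz)) hz
    (((l2.sub l1).const_mul 2).sub (l3.const_mul p))
  linear_combination key

/-- Splitting the determining equation by powers of the jet coordinates, and then by the dependence
on `u`, gives the reduced system. -/
theorem isReduced_of_determining (hp : p ≠ 0) (hb : b ≠ 0) (hΩ : IsOpen Ω)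
    (hdom : ∀ z ∈ Ω, 0 < z.2.1 ∧ PowerDomain p z.2.2) (hτ : ContDiffOn ℝ ∞ τ Ω)
    (hξ : ContDiffOn ℝ ∞ ξ Ω) (hη : ContDiffOn ℝ ∞ η Ω)
    (h : ∀ z ∈ Ω, ∀ s v m w, determining a b c p n τ ξ η z s v m w = 0) :
    IsReduced a b c p n Ω τ ξ η := by
  have hdom' : ∀ z ∈ Ω, PowerDomain p z.2.2 := fun z hz => (hdom z hz).2
  obtain ⟨hτr, hτu, hξt, hξu⟩ := tau_xi_of_determining hp hb hΩ hdom' hτ hξ h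
  have diff : ∀ {F : Pt → ℝ}, ContDiffOn ℝ ∞ F Ω → ∀ z ∈ Ω, DifferentiableAt ℝ F z :=
    fun hF z hz => differentiableAt_of_contDiffOn hΩ hF hz
  have hβ : ContDiffOn ℝ ∞ (pd (0, 0, 1) η) Ω := contDiffOn_pd hΩ hη _
  have hξr : ContDiffOn ℝ ∞ (pd (0, 1, 0) ξ) Ω := contDiffOn_pd hΩ hξ _
  have hτt : ContDiffOn ℝ ∞ (pd (1, 0, 0) τ) Ω := contDiffOn_pd hΩ hτ _
  have hβr : ContDiffOn ℝ ∞ (pd (0, 1, 0) (pd (0, 0, 1) η)) Ω := contDiffOn_pd hΩ hβ _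
  have hβtt : ContDiffOn ℝ ∞ (pd (1, 0, 0) (pd (1, 0, 0) (pd (0, 0, 1) η))) Ω :=
    contDiffOn_pd hΩ (contDiffOn_pd hΩ hβ _) _
  have hβrr : ContDiffOn ℝ ∞ (pd (0, 1, 0) (pd (0, 1, 0) (pd (0, 0, 1) η))) Ω :=
    contDiffOn_pd hΩ hβr _
  have hξrr : ContDiffOn ℝ ∞ (pd (0, 1, 0) (pd (0, 1, 0) ξ)) Ω := contDiffOn_pd hΩ hξr _
  -- The coefficients of `u_rr`, `u_t ^ 2`, `u_t`, `u_r` and `1` in the determining equation.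
  have D := fun z hz s v w => (determining_eq (a := a) (b := b) (c := c) (p := p) (n := n) (η := η)
    hΩ hτr hτu hξt hξu hz s v 0 w).symm.trans (h z hz s v 0 w)
  have coef_w : ∀ z ∈ Ω, 2 * (c + b * z.2.2 ^ p) * (pd (0, 1, 0) ξ z - pd (1, 0, 0) τ z)
      - b * (p * z.2.2 ^ (p - 1)) * η z = 0 := fun z hz => by
    linear_combination D z hz 0 0 1 - D z hz 0 0 0
  have hβu : ∀ z ∈ Ω, pd (0, 0, 1) (pd (0, 0, 1) η) z = 0 := fun z hz => by
    linear_combination (D z hz 1 0 0 + D z hz (-1) 0 0 - 2 * D z hz 0 0 0) / 2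
  have coef_s : ∀ z ∈ Ω, 2 * pd (1, 0, 0) (pd (0, 0, 1) η) z = pd (1, 0, 0) (pd (1, 0, 0) τ) z :=
    fun z hz => by linear_combination (D z hz 1 0 0 - D z hz (-1) 0 0) / 2
  have coef_v : ∀ z ∈ Ω, (c + b * z.2.2 ^ p) * (-(n - 1) / z.2.1 * pd (0, 1, 0) ξ z
      - 2 * pd (0, 1, 0) (pd (0, 0, 1) η) z + pd (0, 1, 0) (pd (0, 1, 0) ξ) z
      + (n - 1) / z.2.1 ^ 2 * ξ z) - 2 * a * z.2.2 ^ (p - 1) * pd (0, 1, 0) η z = 0 :=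
    fun z hz => by
      linear_combination (D z hz 0 1 0 - D z hz 0 (-1) 0) / 2 - (n - 1) / z.2.1 * coef_w z hz
  have coef_1 : ∀ z ∈ Ω, pd (1, 0, 0) (pd (1, 0, 0) η) z - (c + b * z.2.2 ^ p)
      * (pd (0, 1, 0) (pd (0, 1, 0) η) z + (n - 1) / z.2.1 * pd (0, 1, 0) η z) = 0 :=
    fun z hz => by linear_combination D z hz 0 0 0
  clear D
  -- Derivatives in `u` of functions that do not depend on `u`.
  have hξru : ∀ z ∈ Ω, pd (0, 0, 1) (pd (0, 1, 0) ξ) z = 0 := fun z hz => by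
    rw [pd_comm hΩ hξ _ _ hz, pd_eq_zero hΩ hξu _ z hz]
  have hτtu : ∀ z ∈ Ω, pd (0, 0, 1) (pd (1, 0, 0) τ) z = 0 := fun z hz => by
    rw [pd_comm hΩ hτ _ _ hz, pd_eq_zero hΩ hτu _ z hz]
  have commβ : ∀ e : Pt, ∀ z ∈ Ω, pd (0, 0, 1) (pd e (pd (0, 0, 1) η)) z = 0 := fun e z hz => by
    rw [pd_comm hΩ hβ _ _ hz, pd_eq_zero hΩ hβu _ z hz]
  have commβ₂ : ∀ e : Pt, ∀ z ∈ Ω, pd (0, 0, 1) (pd e (pd e (pd (0, 0, 1) η))) z = 0 :=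
    fun e z hz => by
      rw [pd_comm hΩ (contDiffOn_pd hΩ hβ _) _ _ hz, pd_eq_zero hΩ (commβ e) _ z hz]
  have line_ξr : ∀ z ∈ Ω, HasDerivAt (fun s => pd (0, 1, 0) ξ (z.1, z.2.1, s)) 0 z.2.2 :=
    fun z hz => by simpa only [hξru z hz] using hasDerivAt_line_u (diff hξr z hz)
  have line_τt : ∀ z ∈ Ω, HasDerivAt (fun s => pd (1, 0, 0) τ (z.1, z.2.1, s)) 0 z.2.2 :=
    fun z hz => by simpa only [hτtu z hz] using hasDerivAt_line_u (diff hτt z hz)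
  have line_β : ∀ z ∈ Ω, HasDerivAt (fun s => pd (0, 0, 1) η (z.1, z.2.1, s)) 0 z.2.2 :=
    fun z hz => by simpa only [hβu z hz] using hasDerivAt_line_u (diff hβ z hz)
  -- First consequence of `2 g (ξ_r - τ_t) = g_u η`: differentiate in `u`, multiply by `u`.
  have euler : ∀ z ∈ Ω, 2 * z.2.2 * (pd (0, 1, 0) ξ z - pd (1, 0, 0) τ z) - (p - 1) * η z
      - z.2.2 * pd (0, 0, 1) η z = 0 := by
    refine eq_zero_of_rpow_mul hΩ hdom' (fun z hz => ?_) fun z hz => ?_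
    · have h1 := (diff hξr z hz).continuousAt
      have h2 := (diff hτt z hz).continuousAt
      have h3 := (diff hη z hz).continuousAt
      have h4 := (diff hβ z hz).continuousAt
      fun_prop
    · have key := line_u_eq_zero (F := fun z => 2 * (c + b * z.2.2 ^ p)
        * (pd (0, 1, 0) ξ z - pd (1, 0, 0) τ z) - b * (p * z.2.2 ^ (p - 1)) * η z) hΩ coef_w hz
        ((((((hdom' z hz).hasDerivAt_rpow.const_mul b).const_add c).const_mul 2).mul
          ((line_ξr z hz).sub (line_τt z hz))).sub
          ((((hdom' z hz).hasDerivAt_rpow_sub_one.const_mul p).const_mul b).mul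
            (hasDerivAt_line_u (diff hη z hz))))
      simp only [Pi.sub_apply] at key
      have key2 : (b * p) * (z.2.2 ^ (p - 1) * (2 * z.2.2 * (pd (0, 1, 0) ξ z - pd (1, 0, 0) τ z)
          - (p - 1) * η z - z.2.2 * pd (0, 0, 1) η z)) = 0 := by
        linear_combination z.2.2 * key + b * p * η z * PowerDomain.mul_rpow_sub_two p z.2.2
      exact (mul_eq_zero.1 key2).resolve_left (mul_ne_zero hb hp)
  have scaling : ∀ z ∈ Ω, 2 * (pd (0, 1, 0) ξ z - pd (1, 0, 0) τ z) = p * pd (0, 0, 1) η z :=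
    fun z hz => by
      have key := line_u_eq_zero (F := fun z => 2 * z.2.2
        * (pd (0, 1, 0) ξ z - pd (1, 0, 0) τ z) - (p - 1) * η z - z.2.2 * pd (0, 0, 1) η z) hΩ euler
        hz (((((hasDerivAt_id z.2.2).const_mul 2).mul ((line_ξr z hz).sub (line_τt z hz))).sub
          ((hasDerivAt_line_u (diff hη z hz)).const_mul (p - 1))).sub
          ((hasDerivAt_id z.2.2).mul (line_β z hz)))
      simp only [id, Pi.sub_apply] at key
      linear_combination key
  have eta_gen : p ≠ 1 → ∀ z ∈ Ω, η z = z.2.2 * pd (0, 0, 1) η z ∧ c * pd (0, 0, 1) η z = 0 := by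
    intro hp1 z hz
    have h1 : (p - 1) * (η z - z.2.2 * pd (0, 0, 1) η z) = 0 := by
      linear_combination z.2.2 * scaling z hz - euler z hz
    have h2 := (mul_eq_zero.1 h1).resolve_left (sub_ne_zero.2 hp1)
    have h3 : p * (c * pd (0, 0, 1) η z) = 0 := by
      linear_combination coef_w z hz - (c + b * z.2.2 ^ p) * scaling z hz
        + b * p * z.2.2 ^ (p - 1) * h2
        + b * p * pd (0, 0, 1) η z * (hdom' z hz).mul_rpow_sub_one
    exact ⟨sub_eq_zero.1 h2, (mul_eq_zero.1 h3).resolve_left hp⟩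
  have eta_eq : ∀ z ∈ Ω, b * η z = pd (0, 0, 1) η z * (b * z.2.2 + p * c) := fun z hz => by
    by_cases hp1 : p = 1
    · subst hp1
      have h1 := coef_w z hz
      simp only [sub_self, Real.rpow_zero, Real.rpow_one] at h1
      linear_combination (c + b * z.2.2) * scaling z hz - h1
    · obtain ⟨h1, h2⟩ := eta_gen hp1 z hz
      linear_combination b * h1 - p * h2
  have generic : c ≠ 0 → p ≠ 1 → ∀ z ∈ Ω, pd (0, 0, 1) η z = 0 := fun hc hp1 z hz =>
    (mul_eq_zero.1 (eta_gen hp1 z hz).2).resolve_left hc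
  have hr0 : ∀ z ∈ Ω, z.2.1 ≠ 0 := fun z hz => (hdom z hz).1.ne'
  -- The coefficient of `1` is `u + p c / b` times the wave equation for `β = η_u`.
  have eta_t := pd_mul_shift hΩ hη hβ eta_eq (e := (1, 0, 0)) rfl
  have eta_tt := pd_mul_shift hΩ (contDiffOn_pd hΩ hη _) (contDiffOn_pd hΩ hβ _) eta_t
    (e := (1, 0, 0)) rfl
  have eta_r := pd_mul_shift hΩ hη hβ eta_eq (e := (0, 1, 0)) rfl
  have eta_rr := pd_mul_shift hΩ (contDiffOn_pd hΩ hη _) (contDiffOn_pd hΩ hβ _) eta_r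
    (e := (0, 1, 0)) rfl
  have dpow : ∀ z ∈ Ω, DifferentiableAt ℝ (fun z : Pt => z.2.2 ^ p) z := fun z hz =>
    DifferentiableAt.comp (g := fun x : ℝ => x ^ p) (f := fun z : Pt => z.2.2) z
      (hdom' z hz).hasDerivAt_rpow.differentiableAt (by fun_prop)
  have wave_β : ∀ z ∈ Ω, pd (1, 0, 0) (pd (1, 0, 0) (pd (0, 0, 1) η)) z - (c + b * z.2.2 ^ p)
      * (pd (0, 1, 0) (pd (0, 1, 0) (pd (0, 0, 1) η)) z
        + (n - 1) / z.2.1 * pd (0, 1, 0) (pd (0, 0, 1) η) z) = 0 := by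
    have key := deriv_mul_eq_zero (φ := fun u => b * u + p * c) (φ' := fun _ => b * 1)
      (F := fun z => pd (1, 0, 0) (pd (1, 0, 0) (pd (0, 0, 1) η)) z - (c + b * z.2.2 ^ p)
      * (pd (0, 1, 0) (pd (0, 1, 0) (pd (0, 0, 1) η)) z
        + (n - 1) / z.2.1 * pd (0, 1, 0) (pd (0, 0, 1) η) z)) hΩ
      (fun z _ => ((hasDerivAt_id z.2.2).const_mul b).add_const (p * c)) (fun z hz => by
        have h1 := diff hβtt z hz
        have h2 := diff hβrr z hz
        have h3 := diff hβr z hz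
        have h4 := dpow z hz
        have h5 := hr0 z hz
        fun_prop (disch := assumption)) fun z hz => by
        linear_combination b * coef_1 z hz - eta_tt z hz + (c + b * z.2.2 ^ p) * (eta_rr z hz
          + (n - 1) / z.2.1 * eta_r z hz)
    exact fun z hz => by simpa [hb] using key z hz
  have laplace_β : ∀ z ∈ Ω, pd (0, 1, 0) (pd (0, 1, 0) (pd (0, 0, 1) η)) z
        + (n - 1) / z.2.1 * pd (0, 1, 0) (pd (0, 0, 1) η) z = 0 := by
    refine eq_zero_of_rpow_mul hΩ hdom' (fun z hz => ?_) fun z hz => ?_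
    · have h2 := (diff hβrr z hz).continuousAt
      have h3 := (diff hβr z hz).continuousAt
      have h5 := hr0 z hz
      fun_prop (disch := assumption)
    · have l1 := hasDerivAt_line_u (diff hβtt z hz)
      have l2 := hasDerivAt_line_u (diff hβrr z hz)
      have l3 := hasDerivAt_line_u (diff hβr z hz)
      rw [commβ₂ _ z hz] at l1 l2
      rw [commβ _ z hz] at l3
      have key := line_u_eq_zero (F := fun z => pd (1, 0, 0) (pd (1, 0, 0) (pd (0, 0, 1) η)) z
        - (c + b * z.2.2 ^ p) * (pd (0, 1, 0) (pd (0, 1, 0) (pd (0, 0, 1) η)) z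
        + (n - 1) / z.2.1 * pd (0, 1, 0) (pd (0, 0, 1) η) z)) hΩ wave_β hz
        (l1.sub ((((hdom' z hz).hasDerivAt_rpow.const_mul b).const_add c).mul
          (l2.add (l3.const_mul ((n - 1) / z.2.1)))))
      have key2 : (b * p) * (z.2.2 ^ (p - 1) * (pd (0, 1, 0) (pd (0, 1, 0) (pd (0, 0, 1) η)) z
          + (n - 1) / z.2.1 * pd (0, 1, 0) (pd (0, 0, 1) η) z)) = 0 := by
        linear_combination -key
      exact (mul_eq_zero.1 key2).resolve_left (mul_ne_zero hb hp)
  have xi_rr : ∀ z ∈ Ω, 2 * pd (0, 1, 0) (pd (0, 1, 0) ξ) z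
      = p * pd (0, 1, 0) (pd (0, 0, 1) η) z := fun z hz => scaling_r hΩ hτ hξ hη hτr scaling hz
  -- Here `u ^ (p - 1) (b u + p c) = g` unless `β = 0`, so the coefficient of `u_r` contains `g`.
  have coef_v' : ∀ z ∈ Ω, b * (-(n - 1) / z.2.1 * pd (0, 1, 0) ξ z
      - 2 * pd (0, 1, 0) (pd (0, 0, 1) η) z + pd (0, 1, 0) (pd (0, 1, 0) ξ) z
      + (n - 1) / z.2.1 ^ 2 * ξ z) - 2 * a * pd (0, 1, 0) (pd (0, 0, 1) η) z = 0 := by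
    refine eq_zero_of_g_mul (c := c) hp hb hΩ hdom' (fun z hz => ?_) fun z hz => ?_
    · have h1 := diff hξr z hz
      have h2 := diff hξrr z hz
      have h3 := diff hβr z hz
      have h4 := diff hξ z hz
      have h5 := hr0 z hz
      have h6 := pow_ne_zero 2 h5
      fun_prop (disch := assumption)
    · have hg : pd (0, 1, 0) (pd (0, 0, 1) η) z
          * (z.2.2 ^ (p - 1) * (b * z.2.2 + p * c) - (c + b * z.2.2 ^ p)) = 0 := by
        have hm := (hdom' z hz).mul_rpow_sub_one
        by_cases hc : c = 0
        · subst hc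
          linear_combination pd (0, 1, 0) (pd (0, 0, 1) η) z * b * hm
        · by_cases hp1 : p = 1
          · subst hp1
            simp only [sub_self, Real.rpow_zero, Real.rpow_one]
            ring
          · rw [pd_eq_zero hΩ (generic hc hp1) _ z hz, zero_mul]
      linear_combination b * coef_v z hz + 2 * a * hg + 2 * a * z.2.2 ^ (p - 1) * eta_r z hz
  refine ⟨hτr, hτu, hξt, hξu, hβu, eta_eq, scaling, coef_s, fun z hz => ?_, fun z hz => ?_,
    fun z hz => ?_, generic⟩
  · linear_combination wave_β z hz + (c + b * z.2.2 ^ p) * laplace_β z hz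
  · have h5 := hr0 z hz
    have := laplace_β z hz
    field_simp at this
    linear_combination this
  · have h5 := hr0 z hz
    have := coef_v' z hz
    field_simp at this
    linear_combination this - z.2.1 ^ 2 * b / 2 * xi_rr z hz

/-- The reduced system is also sufficient: each coefficient of the determining equation vanishes. -/
theorem IsReduced.determining_eq_zero (hb : b ≠ 0) (hΩ : IsOpen Ω)
    (hdom : ∀ z ∈ Ω, 0 < z.2.1 ∧ PowerDomain p z.2.2) (hτ : ContDiffOn ℝ ∞ τ Ω)
    (hξ : ContDiffOn ℝ ∞ ξ Ω) (hη : ContDiffOn ℝ ∞ η Ω) (h : IsReduced a b c p n Ω τ ξ η)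
    {z : Pt} (hz : z ∈ Ω) (s v m w : ℝ) : determining a b c p n τ ξ η z s v m w = 0 := by
  have eta_r := pd_mul_shift hΩ hη (contDiffOn_pd hΩ hη _) h.eta_eq (e := (0, 1, 0)) rfl
  have eta_rr := pd_mul_shift hΩ (contDiffOn_pd hΩ hη _)
    (contDiffOn_pd hΩ (contDiffOn_pd hΩ hη _) _) eta_r (e := (0, 1, 0)) rfl
  have eta_t := pd_mul_shift hΩ hη (contDiffOn_pd hΩ hη _) h.eta_eq (e := (1, 0, 0)) rfl
  have eta_tt := pd_mul_shift hΩ (contDiffOn_pd hΩ hη _)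
    (contDiffOn_pd hΩ (contDiffOn_pd hΩ hη _) _) eta_t (e := (1, 0, 0)) rfl z hz
  have xi_rr : 2 * pd (0, 1, 0) (pd (0, 1, 0) ξ) z = p * pd (0, 1, 0) (pd (0, 0, 1) η) z :=
    scaling_r hΩ hτ hξ hη h.tau_r h.scaling hz
  replace eta_r := eta_r z hz
  replace eta_rr := eta_rr z hz
  have hr := (hdom z hz).1.ne'
  have hm := (hdom z hz).2.mul_rpow_sub_one
  have hm2 := PowerDomain.mul_rpow_sub_two p z.2.2
  -- In every case `u ^ (p - 1) (b u + p c) = g` and `(p - 1) c u ^ (p - 2) = 0` wherever `β ≠ 0`.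
  have alt : ∀ y : ℝ, (c ≠ 0 → p ≠ 1 → y = 0) →
      y * (z.2.2 ^ (p - 1) * (b * z.2.2 + p * c)) = y * (c + b * z.2.2 ^ p) ∧
        y * (c * ((p - 1) * z.2.2 ^ (p - 1 - 1))) = 0 := by
    intro y hy
    by_cases hc : c = 0
    · subst hc
      exact ⟨by linear_combination y * b * hm, by ring⟩
    · by_cases hp1 : p = 1
      · subst hp1
        simp only [sub_self, Real.rpow_zero, Real.rpow_one]
        exact ⟨by ring, by ring⟩
      · simp [hy hc hp1]
  obtain ⟨hβ1, hβ2⟩ := alt _ fun hc hp1 => h.generic hc hp1 z hz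
  obtain ⟨hβr, -⟩ := alt _ fun hc hp1 => pd_eq_zero hΩ (h.generic hc hp1) (0, 1, 0) z hz
  have sc := h.scaling z hz
  have coef_w : 2 * (c + b * z.2.2 ^ p) * (pd (0, 1, 0) ξ z - pd (1, 0, 0) τ z)
      - b * (p * z.2.2 ^ (p - 1)) * η z = 0 := by
    linear_combination (c + b * z.2.2 ^ p) * sc - p * z.2.2 ^ (p - 1) * h.eta_eq z hz - p * hβ1
  have coef_vv : b * (2 * z.2.2 ^ (p - 1) * (pd (0, 1, 0) ξ z - pd (1, 0, 0) τ z)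
      - z.2.2 ^ (p - 1) * pd (0, 0, 1) η z - (p - 1) * z.2.2 ^ (p - 1 - 1) * η z) = 0 := by
    linear_combination b * z.2.2 ^ (p - 1) * sc
      - (p - 1) * z.2.2 ^ (p - 1 - 1) * h.eta_eq z hz - b * pd (0, 0, 1) η z * hm2 - p * hβ2
  replace coef_vv := (mul_eq_zero.1 coef_vv).resolve_left hb
  have coef_v : b * z.2.1 ^ 2 * ((c + b * z.2.2 ^ p) * (-(n - 1) / z.2.1 * pd (0, 1, 0) ξ z
      - 2 * pd (0, 1, 0) (pd (0, 0, 1) η) z + pd (0, 1, 0) (pd (0, 1, 0) ξ) z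
      + (n - 1) / z.2.1 ^ 2 * ξ z) - 2 * a * z.2.2 ^ (p - 1) * pd (0, 1, 0) η z) = 0 := by
    have e1 : z.2.1 ^ 2 * (-(n - 1) / z.2.1 * pd (0, 1, 0) ξ z
        + (n - 1) / z.2.1 ^ 2 * ξ z) = -(n - 1) * (z.2.1 * pd (0, 1, 0) ξ z - ξ z) := by
      field_simp
      ring
    linear_combination (c + b * z.2.2 ^ p) * b * e1 + (c + b * z.2.2 ^ p) * h.xi_eq z hz
      + z.2.1 ^ 2 * b * (c + b * z.2.2 ^ p) / 2 * xi_rr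
      - 2 * a * z.2.1 ^ 2 * z.2.2 ^ (p - 1) * eta_r - 2 * a * z.2.1 ^ 2 * hβr
  replace coef_v := (mul_eq_zero.1 coef_v).resolve_left (mul_ne_zero hb (pow_ne_zero 2 hr))
  have coef_1 : b * z.2.1 * (pd (1, 0, 0) (pd (1, 0, 0) η) z - (c + b * z.2.2 ^ p)
      * (pd (0, 1, 0) (pd (0, 1, 0) η) z + (n - 1) / z.2.1 * pd (0, 1, 0) η z)) = 0 := by
    have e1 : z.2.1 * ((n - 1) / z.2.1 * pd (0, 1, 0) η z) = (n - 1) * pd (0, 1, 0) η z := by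
      field_simp
    linear_combination z.2.1 * eta_tt + z.2.1 * (b * z.2.2 + p * c) * h.eta_ttu z hz
      - (c + b * z.2.2 ^ p) * (z.2.1 * eta_rr + (n - 1) * eta_r + b * e1
        + (b * z.2.2 + p * c) * h.eta_rru z hz)
  replace coef_1 := (mul_eq_zero.1 coef_1).resolve_left (mul_ne_zero hb hr)
  rw [determining_eq hΩ h.tau_r h.tau_u h.xi_t h.xi_u hz]
  linear_combination coef_1 + v * coef_v + (w + v * ((n - 1) / z.2.1)) * coef_w
    + a * v ^ 2 * coef_vv + s * h.eta_tu z hz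
    + (s ^ 2 - (c + b * z.2.2 ^ p) * v ^ 2) * h.eta_uu z hz

end Reduction

/-! ### The non-rigid and logarithmic dilations -/

/-- The generator with a nontrivial dependence on `r`: the logarithmic dilation for `n = 2`, the
non-rigid dilation otherwise. -/
def radialGenerator (a b c p n : ℝ) : Generator := if n = 2 then X5 b c p else X4 a b c p n

/-- The coefficient of `∂/∂r` in `radialGenerator`. -/
def radialXi (a b c p n r : ℝ) : ℝ :=
  if n = 2 then p * b * r * Real.log r / 2 else (a + b + (1 - p) * c) * r ^ (3 - n)

/-- The factor of `b u + p c` in the coefficient of `∂/∂u` in `radialGenerator`, when `c = 0` or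
`p = 1`. -/
def radialProfile (n r : ℝ) : ℝ := if n = 2 then 1 + Real.log r else (2 - n) * r ^ (2 - n)

/-- The nonzero constant `σ` such that `radialProfile` has the derivative `σ r ^ (1 - n)`. -/
def profileSlope (n : ℝ) : ℝ := if n = 2 then 1 else (2 - n) ^ 2

section RadialGenerator

variable {a b c p n r : ℝ}

theorem profileSlope_ne_zero : profileSlope n ≠ 0 := by
  unfold profileSlope
  split_ifs with h
  · exact one_ne_zero
  · exact pow_ne_zero 2 (sub_ne_zero.2 (Ne.symm h))

theorem rpow_two_sub (hr : 0 < r) : r ^ (2 - n) = r * r ^ (1 - n) := by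
  rw [show 2 - n = 1 + (1 - n) by ring, Real.rpow_add hr, Real.rpow_one]

theorem rpow_three_sub (hr : 0 < r) : r ^ (3 - n) = r ^ 2 * r ^ (1 - n) := by
  rw [show 3 - n = 2 + (1 - n) by ring, Real.rpow_add hr, Real.rpow_two]

theorem hasDerivAt_rpow_one_sub (hr : 0 < r) :
    HasDerivAt (fun r : ℝ => r ^ (1 - n)) ((1 - n) * (r ^ (1 - n) / r)) r :=
  (Real.hasDerivAt_rpow_const (.inl hr.ne')).congr_deriv (by rw [Real.rpow_sub_one hr.ne'])

theorem hasDerivAt_radialProfile (hr : 0 < r) :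
    HasDerivAt (radialProfile n) (profileSlope n * r ^ (1 - n)) r := by
  unfold radialProfile profileSlope
  split_ifs with h
  · subst h
    refine ((Real.hasDerivAt_log hr.ne').const_add 1).congr_deriv ?_
    rw [show (1 : ℝ) - 2 = -1 by norm_num, Real.rpow_neg_one, one_mul]
  · refine ((Real.hasDerivAt_rpow_const (p := 2 - n) (.inl hr.ne')).const_mul
      (2 - n)).congr_deriv ?_
    rw [show 2 - n - 1 = 1 - n by ring]
    ring

theorem radialGenerator_eq (z : Pt) (hc : (1 - p) * c = 0) : radialGenerator a b c p n z =
    (0, radialXi a b c p n z.2.1, radialProfile n z.2.1 * (b * z.2.2 + p * c)) := by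
  unfold radialGenerator radialXi radialProfile
  split_ifs with h
  · rfl
  · simp [X4, hc]

theorem hasDerivAt_radialXi (hc : (1 - p) * c = 0)
    (hρ : a * (n - 3) + b * (n - 3 - p * (n - 2) / 2) = 0) (hr : 0 < r) :
    HasDerivAt (radialXi a b c p n) (p * b / 2 * radialProfile n r) r := by
  unfold radialXi radialProfile
  split_ifs with h
  · refine ((((hasDerivAt_id r).const_mul (p * b)).mul (Real.hasDerivAt_log hr.ne')).div_const
      2).congr_deriv ?_
    simp only [id]
    field_simp
    ring
  · refine ((Real.hasDerivAt_rpow_const (p := 3 - n) (.inl hr.ne')).const_mul _).congr_deriv ?_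
    rw [show 3 - n - 1 = 2 - n by ring]
    linear_combination (3 - n) * r ^ (2 - n) * hc - r ^ (2 - n) * hρ

/-- The radial generator satisfies the equation `IsReduced.xi_eq` between `ξ` and `β`. -/
theorem radialXi_eq (hc : (1 - p) * c = 0)
    (hρ : a * (n - 3) + b * (n - 3 - p * (n - 2) / 2) = 0) (hr : 0 < r) :
    r ^ 2 * (b * p / 2 - 2 * b - 2 * a) * (b * (profileSlope n * r ^ (1 - n)))
      = b * (n - 1) * (r * (p * b / 2 * radialProfile n r) - radialXi a b c p n r) := by
  unfold radialXi radialProfile profileSlope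
  split_ifs with h
  · subst h
    rw [show (1 : ℝ) - 2 = -1 by norm_num, Real.rpow_neg_one]
    field_simp
    linear_combination 4 * b * hρ
  · rw [rpow_two_sub hr, rpow_three_sub hr]
    linear_combination b * r ^ 2 * r ^ (1 - n) * (n - 1) * hc
      - (2 * n - 3) * b * r ^ 2 * r ^ (1 - n) * hρ

end RadialGenerator

/-! ### Integration of the reduced determining equations -/

section Integration

variable {a b c p n : ℝ} {Ω : Set Pt} {τ ξ η : Pt → ℝ}

/-- On a connected domain the reduced determining equations force `τ` to be a quadratic polynomial
and `η_u` to be a combination of `t`, `1` and `radialProfile`; then `ξ` is determined. -/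
theorem IsReduced.exists_coefficients (hΩ : IsOpen Ω)
    (hconn : IsConnected Ω)
    (hdom : ∀ z ∈ Ω, 0 < z.2.1) (hτ : ContDiffOn ℝ ∞ τ Ω)
    (hξ : ContDiffOn ℝ ∞ ξ Ω) (hη : ContDiffOn ℝ ∞ η Ω) (h : IsReduced a b c p n Ω τ ξ η) :
    ∃ k₀ k₁ k₂ K B : ℝ, (p + 4) * k₂ = 0 ∧
      (a * (n - 3) + b * (n - 3 - p * (n - 2) / 2)) * K = 0 ∧
      (c ≠ 0 → p ≠ 1 → k₂ = 0 ∧ K = 0 ∧ B = 0) ∧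
      ∀ z ∈ Ω, τ z = k₀ + k₁ * z.1 + k₂ * z.1 ^ 2 ∧
        b * (n - 1) * ξ z = b * (n - 1) * z.2.1 * (p / 2 * (K * radialProfile n z.2.1 + B) + k₁)
          - z.2.1 ^ 2 * (b * p / 2 - 2 * b - 2 * a) * (K * (profileSlope n * z.2.1 ^ (1 - n))) ∧
        b * η z = (K * radialProfile n z.2.1 + B + k₂ * z.1) * (b * z.2.2 + p * c) := by
  have diff : ∀ {F : Pt → ℝ}, ContDiffOn ℝ ∞ F Ω → ∀ z ∈ Ω, DifferentiableAt ℝ F z :=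
    fun hF z hz => differentiableAt_of_contDiffOn hΩ hF hz
  have hβ : ContDiffOn ℝ ∞ (pd (0, 0, 1) η) Ω := contDiffOn_pd hΩ hη _
  have hβt : ContDiffOn ℝ ∞ (pd (1, 0, 0) (pd (0, 0, 1) η)) Ω := contDiffOn_pd hΩ hβ _
  have hβr : ContDiffOn ℝ ∞ (pd (0, 1, 0) (pd (0, 0, 1) η)) Ω := contDiffOn_pd hΩ hβ _
  have hξr : ContDiffOn ℝ ∞ (pd (0, 1, 0) ξ) Ω := contDiffOn_pd hΩ hξ _
  have hτt : ContDiffOn ℝ ∞ (pd (1, 0, 0) τ) Ω := contDiffOn_pd hΩ hτ _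
  have hτtt : ContDiffOn ℝ ∞ (pd (1, 0, 0) (pd (1, 0, 0) τ)) Ω := contDiffOn_pd hΩ hτt _
  have τtr : ∀ z ∈ Ω, pd (0, 1, 0) (pd (1, 0, 0) τ) z = 0 := fun z hz => by
    rw [pd_comm hΩ hτ _ _ hz, pd_eq_zero hΩ h.tau_r _ z hz]
  have τtu : ∀ z ∈ Ω, pd (0, 0, 1) (pd (1, 0, 0) τ) z = 0 := fun z hz => by
    rw [pd_comm hΩ hτ _ _ hz, pd_eq_zero hΩ h.tau_u _ z hz]
  have τttr : ∀ z ∈ Ω, pd (0, 1, 0) (pd (1, 0, 0) (pd (1, 0, 0) τ)) z = 0 := fun z hz => by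
    rw [pd_comm hΩ hτt _ _ hz, pd_eq_zero hΩ τtr _ z hz]
  have τttu : ∀ z ∈ Ω, pd (0, 0, 1) (pd (1, 0, 0) (pd (1, 0, 0) τ)) z = 0 := fun z hz => by
    rw [pd_comm hΩ hτt _ _ hz, pd_eq_zero hΩ τtu _ z hz]
  have τttt : ∀ z ∈ Ω, pd (1, 0, 0) (pd (1, 0, 0) (pd (1, 0, 0) τ)) z = 0 := fun z hz => by
    have := line_t_eq_zero (F := fun z => 2 * pd (1, 0, 0) (pd (0, 0, 1) η) z
      - pd (1, 0, 0) (pd (1, 0, 0) τ) z) hΩ (fun z hz => sub_eq_zero.2 (h.eta_tu z hz)) hz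
      (((hasDerivAt_line_t (diff hβt z hz)).const_mul 2).sub (hasDerivAt_line_t (diff hτtt z hz)))
    linear_combination 2 * h.eta_ttu z hz - this
  have βtr : ∀ z ∈ Ω, pd (1, 0, 0) (pd (0, 1, 0) (pd (0, 0, 1) η)) z = 0 := fun z hz => by
    rw [pd_comm hΩ hβ _ _ hz]
    have := line_r_eq_zero (F := fun z => 2 * pd (1, 0, 0) (pd (0, 0, 1) η) z
      - pd (1, 0, 0) (pd (1, 0, 0) τ) z) hΩ (fun z hz => sub_eq_zero.2 (h.eta_tu z hz)) hz
      (((hasDerivAt_line_r (diff hβt z hz)).const_mul 2).sub (hasDerivAt_line_r (diff hτtt z hz)))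
    linear_combination (this + τttr z hz) / 2
  have βru : ∀ z ∈ Ω, pd (0, 0, 1) (pd (0, 1, 0) (pd (0, 0, 1) η)) z = 0 := fun z hz => by
    rw [pd_comm hΩ hβ _ _ hz, pd_eq_zero hΩ h.eta_uu _ z hz]
  -- The constants `k₂`, `k₁`, `k₀` of the quadratic polynomial `τ`.
  obtain ⟨k, hk⟩ := exists_eq_const hΩ hconn (diff hτtt)
    (fun z hz => (hasDerivAt_line_t (diff hτtt z hz)).congr_deriv (τttt z hz))
    (fun z hz => (hasDerivAt_line_r (diff hτtt z hz)).congr_deriv (τttr z hz))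
    (fun z hz => (hasDerivAt_line_u (diff hτtt z hz)).congr_deriv (τttu z hz))
  obtain ⟨k₁, hk₁⟩ := exists_eq_const (F := fun z => pd (1, 0, 0) τ z - k * z.1) hΩ hconn
    (fun z hz => (diff hτt z hz).sub (by fun_prop))
    (fun z hz => ((hasDerivAt_line_t (diff hτt z hz)).sub
      ((hasDerivAt_id z.1).const_mul k)).congr_deriv (by rw [hk z hz]; ring))
    (fun z hz => ((hasDerivAt_line_r (diff hτt z hz)).sub_const (k * z.1)).congr_deriv (τtr z hz))
    (fun z hz => ((hasDerivAt_line_u (diff hτt z hz)).sub_const (k * z.1)).congr_deriv (τtu z hz))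
  obtain ⟨k₀, hk₀⟩ := exists_eq_const (F := fun z => τ z - (k₁ * z.1 + k / 2 * z.1 ^ 2)) hΩ hconn
    (fun z hz => (diff hτ z hz).sub (by fun_prop))
    (fun z hz => ((hasDerivAt_line_t (diff hτ z hz)).sub
      (((hasDerivAt_id z.1).const_mul k₁).add
        (((hasDerivAt_id z.1).pow 2).const_mul (k / 2)))).congr_deriv (by
          simp only [id]
          push_cast
          linear_combination hk₁ z hz))
    (fun z hz => ((hasDerivAt_line_r (diff hτ z hz)).sub_const
      (k₁ * z.1 + k / 2 * z.1 ^ 2)).congr_deriv (h.tau_r z hz))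
    (fun z hz => ((hasDerivAt_line_u (diff hτ z hz)).sub_const
      (k₁ * z.1 + k / 2 * z.1 ^ 2)).congr_deriv (h.tau_u z hz))
  -- By `r β_rr + (n - 1) β_r = 0`, the function `r ^ (n - 1) β_r` is constant.
  have hpow : ∀ z ∈ Ω, z.2.1 ^ (1 - n) ≠ 0 := fun z hz => (Real.rpow_pos_of_pos (hdom z hz) _).ne'
  obtain ⟨K₀, hK₀⟩ := exists_eq_const
    (F := fun z => pd (0, 1, 0) (pd (0, 0, 1) η) z / z.2.1 ^ (1 - n)) hΩ hconn
    (fun z hz => by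
      have h1 := diff hβr z hz
      have h2 : DifferentiableAt ℝ (fun z : Pt => z.2.1 ^ (1 - n)) z :=
        DifferentiableAt.comp (g := fun r : ℝ => r ^ (1 - n)) (f := fun z : Pt => z.2.1) z
          (hasDerivAt_rpow_one_sub (hdom z hz)).differentiableAt (by fun_prop)
      have h3 := hpow z hz
      fun_prop (disch := assumption))
    (fun z hz => ((hasDerivAt_line_t (diff hβr z hz)).div_const (z.2.1 ^ (1 - n))).congr_deriv (by
      rw [βtr z hz, zero_div]))
    (fun z hz => ((hasDerivAt_line_r (diff hβr z hz)).div
      (hasDerivAt_rpow_one_sub (hdom z hz)) (hpow z hz)).congr_deriv (by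
        have h1 := (hdom z hz).ne'
        have h2 := hpow z hz
        have h3 := h.eta_rru z hz
        simp only [Prod.mk.eta]
        field_simp
        linear_combination h3))
    (fun z hz => ((hasDerivAt_line_u (diff hβr z hz)).div_const (z.2.1 ^ (1 - n))).congr_deriv (by
      rw [βru z hz, zero_div]))
  have hβrK : ∀ z ∈ Ω, pd (0, 1, 0) (pd (0, 0, 1) η) z = K₀ * z.2.1 ^ (1 - n) := fun z hz =>
    (div_eq_iff (hpow z hz)).1 (hK₀ z hz)
  have hσ : profileSlope n ≠ 0 := profileSlope_ne_zero
  set K := K₀ / profileSlope n with hK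
  have hKσ : K * profileSlope n = K₀ := div_mul_cancel₀ _ hσ
  obtain ⟨B, hB⟩ := exists_eq_const (F := fun z => pd (0, 0, 1) η z
      - (K * radialProfile n z.2.1 + k / 2 * z.1)) hΩ hconn
    (fun z hz => (diff hβ z hz).sub (DifferentiableAt.add (DifferentiableAt.const_mul
      (DifferentiableAt.comp (g := radialProfile n) (f := fun z : Pt => z.2.1) z
        (hasDerivAt_radialProfile (hdom z hz)).differentiableAt (by fun_prop)) K) (by fun_prop)))
    (fun z hz => ((hasDerivAt_line_t (diff hβ z hz)).sub
      (((hasDerivAt_id z.1).const_mul (k / 2)).const_add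
        (K * radialProfile n z.2.1))).congr_deriv (by
        linear_combination h.eta_tu z hz / 2 + hk z hz / 2))
    (fun z hz => ((hasDerivAt_line_r (diff hβ z hz)).sub
      (((hasDerivAt_radialProfile (n := n) (hdom z hz)).const_mul K).add_const
        (k / 2 * z.1))).congr_deriv (by
        linear_combination hβrK z hz - z.2.1 ^ (1 - n) * hKσ))
    (fun z hz => ((hasDerivAt_line_u (diff hβ z hz)).sub_const
      (K * radialProfile n z.2.1 + k / 2 * z.1)).congr_deriv (h.eta_uu z hz))
  obtain ⟨z₀, hz₀⟩ := hconn.nonempty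
  have hk4 : (p + 4) * (k / 2) = 0 := by
    have := line_t_eq_zero (F := fun z => 2 * (pd (0, 1, 0) ξ z - pd (1, 0, 0) τ z)
      - p * pd (0, 0, 1) η z) hΩ (fun z hz => sub_eq_zero.2 (h.scaling z hz)) hz₀
      ((((hasDerivAt_line_t (diff hξr z₀ hz₀)).sub (hasDerivAt_line_t (diff hτt z₀ hz₀))).const_mul
        2).sub ((hasDerivAt_line_t (diff hβ z₀ hz₀)).const_mul p))
    rw [pd_comm hΩ hξ _ _ hz₀, pd_eq_zero hΩ h.xi_t _ z₀ hz₀] at this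
    linear_combination -this - (2 + p / 2) * hk z₀ hz₀ - p / 2 * h.eta_tu z₀ hz₀
  refine ⟨k₀, k₁, k / 2, K, B, hk4, ?_, ?_, fun z hz => ⟨?_, ?_, ?_⟩⟩
  · -- The `r`-derivative of the equation for `ξ` is `2 r ρ β_r = 0`.
    have hr := hdom z₀ hz₀
    have key := line_r_eq_zero (F := fun z => z.2.1 ^ 2 * (b * p / 2 - 2 * b - 2 * a)
      * pd (0, 1, 0) (pd (0, 0, 1) η) z - b * (n - 1) * (z.2.1 * pd (0, 1, 0) ξ z - ξ z)) hΩ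
      (fun z hz => sub_eq_zero.2 (h.xi_eq z hz)) hz₀
      (((((hasDerivAt_id z₀.2.1).pow 2).mul_const (b * p / 2 - 2 * b - 2 * a)).mul
        (hasDerivAt_line_r (diff hβr z₀ hz₀))).sub
        ((((hasDerivAt_id z₀.2.1).mul (hasDerivAt_line_r (diff hξr z₀ hz₀))).sub
          (hasDerivAt_line_r (diff hξ z₀ hz₀))).const_mul (b * (n - 1))))
    simp only [Pi.pow_apply, id] at key
    push_cast at key
    have xi_rr := scaling_r hΩ hτ hξ hη h.tau_r h.scaling hz₀
    have h1 : (2 * profileSlope n * (z₀.2.1 * z₀.2.1 ^ (1 - n)))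
        * ((a * (n - 3) + b * (n - 3 - p * (n - 2) / 2)) * K) = 0 := by
      linear_combination key - z₀.2.1 * (b * p / 2 - 2 * b - 2 * a) * h.eta_rru z₀ hz₀
        + b * (n - 1) * z₀.2.1 / 2 * xi_rr
        + 2 * (a * (n - 3) + b * (n - 3 - p * (n - 2) / 2)) * z₀.2.1 * z₀.2.1 ^ (1 - n) * hKσ
        - 2 * (a * (n - 3) + b * (n - 3 - p * (n - 2) / 2)) * z₀.2.1 * hβrK z₀ hz₀
    exact (mul_eq_zero.1 h1).resolve_left
      (mul_ne_zero (mul_ne_zero two_ne_zero hσ) (mul_ne_zero hr.ne' (hpow z₀ hz₀)))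
  · intro hc hp1
    have hβ0 := h.generic hc hp1
    have hk0 : k / 2 = 0 := by
      linear_combination -hk z₀ hz₀ / 2 - h.eta_tu z₀ hz₀ / 2 + pd_eq_zero hΩ hβ0 (1, 0, 0) z₀ hz₀
    have hK0 : K = 0 := by
      rw [hK, ← hK₀ z₀ hz₀, pd_eq_zero hΩ hβ0 (0, 1, 0) z₀ hz₀, zero_div, zero_div]
    refine ⟨hk0, hK0, ?_⟩
    have := hB z₀ hz₀
    rw [hK0, hk0, hβ0 z₀ hz₀] at this
    linear_combination -this
  · linear_combination hk₀ z hz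
  · linear_combination h.xi_eq z hz + b * (n - 1) * z.2.1 / 2 * h.scaling z hz
      + b * (n - 1) * z.2.1 * (p / 2 * hB z hz + hk₁ z hz + z.1 / 2 * hk4)
      - z.2.1 ^ 2 * (b * p / 2 - 2 * b - 2 * a) * (hβrK z hz - z.2.1 ^ (1 - n) * hKσ)
  · linear_combination h.eta_eq z hz + (b * z.2.2 + p * c) * hB z hz

end Integration

/-! ### Classification of the point symmetries -/

section Classification

variable {a b c p n : ℝ} {Ω : Set Pt} {τ ξ η F : Pt → ℝ} {z : Pt} {y : ℝ}

theorem pd_t_of_eqOn (hΩ : IsOpen Ω) (hF : ContDiffOn ℝ ∞ F Ω) {φ : Pt → ℝ} (h : ∀ z ∈ Ω, F z = φ z)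
    (hz : z ∈ Ω) (hφ : HasDerivAt (fun s => φ (s, z.2.1, z.2.2)) y z.1) : pd (1, 0, 0) F z = y :=
  (hasDerivAt_line_t (differentiableAt_of_contDiffOn hΩ hF hz)).unique
    (hφ.congr_of_eventuallyEq ((eventually_line_t hΩ hz).mono fun _ hs => h _ hs))

theorem pd_r_of_eqOn (hΩ : IsOpen Ω) (hF : ContDiffOn ℝ ∞ F Ω) {φ : Pt → ℝ} (h : ∀ z ∈ Ω, F z = φ z)
    (hz : z ∈ Ω) (hφ : HasDerivAt (fun s => φ (z.1, s, z.2.2)) y z.2.1) : pd (0, 1, 0) F z = y :=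
  (hasDerivAt_line_r (differentiableAt_of_contDiffOn hΩ hF hz)).unique
    (hφ.congr_of_eventuallyEq ((eventually_line_r hΩ hz).mono fun _ hs => h _ hs))

theorem pd_u_of_eqOn (hΩ : IsOpen Ω) (hF : ContDiffOn ℝ ∞ F Ω) {φ : Pt → ℝ} (h : ∀ z ∈ Ω, F z = φ z)
    (hz : z ∈ Ω) (hφ : HasDerivAt (fun s => φ (z.1, z.2.1, s)) y z.2.2) : pd (0, 0, 1) F z = y :=
  (hasDerivAt_line_u (differentiableAt_of_contDiffOn hΩ hF hz)).unique
    (hφ.congr_of_eventuallyEq ((eventually_line_u hΩ hz).mono fun _ hs => h _ hs))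

/-- The reduced determining equations for a generator with quadratic `τ`, with `ξ` a function of
`r`, and with `b η = (M r + k₂ t) (b u + p c)`. -/
theorem isReduced_of_profile (hb : b ≠ 0) (hΩ : IsOpen Ω) (hdom : ∀ z ∈ Ω, 0 < z.2.1)
    (hτ : ContDiffOn ℝ ∞ τ Ω) (hξ : ContDiffOn ℝ ∞ ξ Ω) (hη : ContDiffOn ℝ ∞ η Ω)
    {k₀ k₁ k₂ : ℝ} {R M M' M'' : ℝ → ℝ} (hk₂ : (p + 4) * k₂ = 0)
    (hR : ∀ r, 0 < r → HasDerivAt R (p / 2 * M r + k₁) r)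
    (hM : ∀ r, 0 < r → HasDerivAt M (M' r) r) (hM' : ∀ r, 0 < r → HasDerivAt M' (M'' r) r)
    (hM'' : ∀ r, 0 < r → r * M'' r + (n - 1) * M' r = 0)
    (hRM : ∀ r, 0 < r → r ^ 2 * (b * p / 2 - 2 * b - 2 * a) * M' r
      = b * (n - 1) * (r * (p / 2 * M r + k₁) - R r))
    (hgen : c ≠ 0 → p ≠ 1 → k₂ = 0 ∧ ∀ r, 0 < r → M r = 0)
    (eτ : ∀ z ∈ Ω, τ z = k₀ + k₁ * z.1 + k₂ * z.1 ^ 2) (eξ : ∀ z ∈ Ω, ξ z = R z.2.1)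
    (eη : ∀ z ∈ Ω, b * η z = (M z.2.1 + k₂ * z.1) * (b * z.2.2 + p * c)) :
    IsReduced a b c p n Ω τ ξ η := by
  have eη' : ∀ z ∈ Ω, η z = (M z.2.1 + k₂ * z.1) * (b * z.2.2 + p * c) / b := fun z hz => by
    rw [eq_div_iff hb]
    linear_combination eη z hz
  have hβ : ContDiffOn ℝ ∞ (pd (0, 0, 1) η) Ω := contDiffOn_pd hΩ hη _
  have τt : ∀ z ∈ Ω, pd (1, 0, 0) τ z = k₁ + 2 * k₂ * z.1 := fun z hz =>
    pd_t_of_eqOn hΩ hτ eτ hz (((((hasDerivAt_id z.1).const_mul k₁).const_add k₀).add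
      (((hasDerivAt_id z.1).pow 2).const_mul k₂)).congr_deriv (by simp; ring))
  have τtt : ∀ z ∈ Ω, pd (1, 0, 0) (pd (1, 0, 0) τ) z = 2 * k₂ := fun z hz =>
    pd_t_of_eqOn hΩ (contDiffOn_pd hΩ hτ _) τt hz
      ((((hasDerivAt_id z.1).const_mul (2 * k₂)).const_add k₁).congr_deriv (by ring))
  have ξr : ∀ z ∈ Ω, pd (0, 1, 0) ξ z = p / 2 * M z.2.1 + k₁ := fun z hz =>
    pd_r_of_eqOn hΩ hξ eξ hz (hR _ (hdom z hz))
  have β : ∀ z ∈ Ω, pd (0, 0, 1) η z = M z.2.1 + k₂ * z.1 := fun z hz =>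
    pd_u_of_eqOn hΩ hη eη' hz ((((((hasDerivAt_id z.2.2).const_mul b).add_const (p * c)).const_mul
      (M z.2.1 + k₂ * z.1)).div_const b).congr_deriv (by field_simp))
  have βt : ∀ z ∈ Ω, pd (1, 0, 0) (pd (0, 0, 1) η) z = k₂ := fun z hz =>
    pd_t_of_eqOn hΩ hβ β hz
      ((((hasDerivAt_id z.1).const_mul k₂).const_add (M z.2.1)).congr_deriv (by ring))
  have βr : ∀ z ∈ Ω, pd (0, 1, 0) (pd (0, 0, 1) η) z = M' z.2.1 := fun z hz =>
    pd_r_of_eqOn hΩ hβ β hz ((hM _ (hdom z hz)).add_const (k₂ * z.1))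
  have βrr : ∀ z ∈ Ω, pd (0, 1, 0) (pd (0, 1, 0) (pd (0, 0, 1) η)) z = M'' z.2.1 := fun z hz =>
    pd_r_of_eqOn hΩ (contDiffOn_pd hΩ hβ _) βr hz (hM' _ (hdom z hz))
  refine ⟨fun z hz => pd_r_of_eqOn hΩ hτ eτ hz (hasDerivAt_const _ (k₀ + k₁ * z.1 + k₂ * z.1 ^ 2)),
    fun z hz => pd_u_of_eqOn hΩ hτ eτ hz (hasDerivAt_const _ (k₀ + k₁ * z.1 + k₂ * z.1 ^ 2)),
    fun z hz => pd_t_of_eqOn hΩ hξ eξ hz (hasDerivAt_const _ (R z.2.1)),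
    fun z hz => pd_u_of_eqOn hΩ hξ eξ hz (hasDerivAt_const _ (R z.2.1)),
    fun z hz => pd_u_of_eqOn hΩ hβ β hz (hasDerivAt_const _ (M z.2.1 + k₂ * z.1)),
    fun z hz => ?_, fun z hz => ?_, fun z hz => ?_,
    fun z hz => pd_t_of_eqOn hΩ (contDiffOn_pd hΩ hβ _) βt hz (hasDerivAt_const _ k₂),
    fun z hz => ?_, fun z hz => ?_, fun hc hp1 z hz => ?_⟩
  · rw [β z hz, eη z hz]
  · rw [β z hz, ξr z hz, τt z hz]
    linear_combination (-z.1) * hk₂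
  · rw [βt z hz, τtt z hz]
  · rw [βrr z hz, βr z hz, hM'' _ (hdom z hz)]
  · rw [βr z hz, ξr z hz, eξ z hz, hRM _ (hdom z hz)]
  · obtain ⟨h1, h2⟩ := hgen hc hp1
    rw [β z hz, h1, h2 _ (hdom z hz)]
    ring

theorem contDiffOn_X4 : ContDiffOn ℝ ∞ (X4 a b c p n) {z | 0 < z.2.1} := by
  have h : ∀ q : ℝ, ContDiffOn ℝ ∞ (fun z : Pt => z.2.1 ^ q) {z | 0 < z.2.1} := fun q =>
    ContDiffOn.rpow_const_of_ne (by fun_prop) fun z hz => (show 0 < z.2.1 from hz).ne'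
  have h1 := h (3 - n)
  have h2 := h (2 - n)
  unfold X4
  fun_prop

theorem contDiffOn_X5 : ContDiffOn ℝ ∞ (X5 b c p) {z | 0 < z.2.1} := by
  have h : ContDiffOn ℝ ∞ (fun z : Pt => Real.log z.2.1) {z | 0 < z.2.1} :=
    ContDiffOn.log (by fun_prop) fun z hz => (show 0 < z.2.1 from hz).ne'
  unfold X5
  fun_prop

theorem contDiffOn_radialGenerator :
    ContDiffOn ℝ ∞ (radialGenerator a b c p n) {z | 0 < z.2.1} := by
  unfold radialGenerator
  split_ifs
  · exact contDiffOn_X5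
  · exact contDiffOn_X4

/-- The point symmetries are the combinations of the five generators in which a generator may
occur only if its existence condition holds. -/
theorem isPointSymmetry_iff_exists (hn : n ≠ 1) (hp : p ≠ 0) (hb : b ≠ 0)
    (hΩ : IsOpen Ω) (hconn : IsConnected Ω)
    (hdom : ∀ t r u : ℝ, (t, r, u) ∈ Ω → 0 < r ∧ PowerDomain p u) (X : Generator) :
    IsPointSymmetry (gCoeff b c p) (fCoeff a b c p n) Ω X ↔
      ∃ κ₁ κ₂ κ₃ κ₄ κ₆ : ℝ, (p + 4) * κ₆ = 0 ∧
        (a * (n - 3) + b * (n - 3 - p * (n - 2) / 2)) * κ₄ = 0 ∧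
        (c ≠ 0 → p ≠ 1 → κ₃ = 0 ∧ κ₄ = 0 ∧ κ₆ = 0) ∧
        ∀ z ∈ Ω, X z = κ₁ • X1 z + κ₂ • X2 z + κ₃ • X3 b c p z
          + κ₄ • radialGenerator a b c p n z + κ₆ • X6 z := by
  have hdom' : ∀ z ∈ Ω, 0 < z.2.1 ∧ PowerDomain p z.2.2 := fun z hz => hdom z.1 z.2.1 z.2.2 hz
  have hpos : ∀ z ∈ Ω, 0 < z.2.1 := fun z hz => (hdom' z hz).1
  rw [isPointSymmetry_iff hΩ hdom]
  constructor
  · rintro ⟨hX, hdet⟩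
    have hred := isReduced_of_determining hp hb hΩ hdom' hX.fst hX.snd.fst hX.snd.snd hdet
    obtain ⟨k₀, k₁, k₂, K, B, hk₂, hK, hgen, hcomp⟩ :=
      hred.exists_coefficients hΩ hconn hpos hX.fst hX.snd.fst hX.snd.snd
    have hcK : (1 - p) * c * K = 0 := by
      by_cases hc : c = 0
      · simp [hc]
      · by_cases hp1 : p = 1
        · simp [hp1]
        · simp [(hgen hc hp1).2.1]
    have hck : c * k₂ = 0 := by
      by_cases hc : c = 0
      · simp [hc]
      · by_cases hp1 : p = 1
        · subst hp1
          rw [show k₂ = 0 by linarith, mul_zero]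
        · simp [(hgen hc hp1).1]
    refine ⟨k₀, k₁, B / b, K / b, k₂, hk₂, by rw [← mul_div_assoc, hK, zero_div],
      fun hc hp1 => ?_, fun z hz => ?_⟩
    · obtain ⟨h1, h2, h3⟩ := hgen hc hp1
      simp [h1, h2, h3]
    · obtain ⟨h1, h2, h3⟩ := hcomp z hz
      -- The radial generator has the expected form whenever its coefficient is nonzero.
      have hZ : K • radialGenerator a b c p n z = (0, K * radialXi a b c p n z.2.1,
          K * (radialProfile n z.2.1 * (b * z.2.2 + p * c))) ∧
          K * (z.2.1 ^ 2 * (b * p / 2 - 2 * b - 2 * a) * (b * (profileSlope n * z.2.1 ^ (1 - n))))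
            = K * (b * (n - 1) * (z.2.1 * (p * b / 2 * radialProfile n z.2.1)
              - radialXi a b c p n z.2.1)) := by
        by_cases hK0 : K = 0
        · simp [hK0, Prod.ext_iff]
        · have hc := (mul_eq_zero.1 hcK).resolve_right hK0
          have hρ := (mul_eq_zero.1 hK).resolve_right hK0
          rw [radialGenerator_eq z hc, radialXi_eq hc hρ (hpos z hz)]
          simp
      have hZ' : (K / b) • radialGenerator a b c p n z = b⁻¹ • (0, K * radialXi a b c p n z.2.1,
          K * (radialProfile n z.2.1 * (b * z.2.2 + p * c))) := by
        rw [← hZ.1, smul_smul, div_eq_inv_mul]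
      rw [hZ']
      have hn1 : n - 1 ≠ 0 := sub_ne_zero.2 hn
      refine Prod.ext ?_ (Prod.ext ?_ ?_)
      · simp only [X1, X2, X3, X6, Prod.fst_add, Prod.smul_fst, smul_eq_mul]
        linear_combination h1
      · simp only [X1, X2, X3, X6, Prod.fst_add, Prod.snd_add, Prod.smul_fst, Prod.smul_snd,
          smul_eq_mul]
        refine mul_left_cancel₀ (mul_ne_zero (mul_ne_zero hb hb) hn1) ?_
        linear_combination b * h2 - hZ.2 - (b ^ 2 * (n - 1) * p * B * z.2.1 / 2
          + b * (n - 1) * K * radialXi a b c p n z.2.1) * mul_inv_cancel₀ hb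
      · simp only [X1, X2, X3, X6, Prod.snd_add, Prod.smul_snd, smul_eq_mul]
        refine mul_left_cancel₀ hb ?_
        field_simp
        linear_combination h3 + p * hck * z.1
  · rintro ⟨κ₁, κ₂, κ₃, κ₄, κ₆, h6, h4, hgen, hX⟩
    have hc4 : κ₄ ≠ 0 → (1 - p) * c = 0 := fun h => by
      by_cases hc : c = 0
      · simp [hc]
      · by_cases hp1 : p = 1
        · simp [hp1]
        · exact absurd (hgen hc hp1).2.1 h
    have hck : c * κ₆ = 0 := by
      by_cases hc : c = 0
      · simp [hc]
      · by_cases hp1 : p = 1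
        · subst hp1
          rw [show κ₆ = 0 by linarith, mul_zero]
        · simp [(hgen hc hp1).2.2]
    have hsmooth : ContDiffOn ℝ ∞ X Ω := by
      have hZ : ContDiffOn ℝ ∞ (radialGenerator a b c p n) Ω :=
        contDiffOn_radialGenerator.mono hpos
      have h123 : ContDiffOn ℝ ∞ (fun z => κ₁ • X1 z + κ₂ • X2 z + κ₃ • X3 b c p z) Ω := by
        unfold X1 X2 X3
        fun_prop
      have h6 : ContDiffOn ℝ ∞ (fun z => κ₆ • X6 z) Ω := by
        unfold X6
        fun_prop
      exact ((h123.add (hZ.const_smul κ₄)).add h6).congr hX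
    refine ⟨hsmooth, fun z hz s v m w => ?_⟩
    refine IsReduced.determining_eq_zero hb hΩ hdom' hsmooth.fst hsmooth.snd.fst hsmooth.snd.snd
      ?_ hz s v m w
    have hZ : ∀ z, κ₄ • radialGenerator a b c p n z = (0, κ₄ * radialXi a b c p n z.2.1,
          κ₄ * (radialProfile n z.2.1 * (b * z.2.2 + p * c))) := fun z => by
      by_cases hκ : κ₄ = 0
      · simp [hκ, Prod.ext_iff]
      · rw [radialGenerator_eq z (hc4 hκ)]
        simp
    have hdR : ∀ r, 0 < r → HasDerivAt (fun r => κ₄ * radialXi a b c p n r)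
        (κ₄ * (p * b / 2 * radialProfile n r)) r := fun r hr => by
      by_cases hκ : κ₄ = 0
      · simpa [hκ] using hasDerivAt_const r (0 : ℝ)
      · exact (hasDerivAt_radialXi (hc4 hκ) ((mul_eq_zero.1 h4).resolve_right hκ) hr).const_mul κ₄
    have heR : ∀ r, 0 < r → κ₄ * (r ^ 2 * (b * p / 2 - 2 * b - 2 * a)
        * (b * (profileSlope n * r ^ (1 - n)))) = κ₄ * (b * (n - 1)
          * (r * (p * b / 2 * radialProfile n r) - radialXi a b c p n r)) := fun r hr => by
      by_cases hκ : κ₄ = 0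
      · simp [hκ]
      · rw [radialXi_eq (hc4 hκ) ((mul_eq_zero.1 h4).resolve_right hκ) hr]
    refine isReduced_of_profile (k₀ := κ₁) (k₁ := κ₂) (k₂ := κ₆)
      (R := fun r => κ₂ * r + κ₃ * (p * b / 2) * r + κ₄ * radialXi a b c p n r)
      (M := fun r => b * (κ₃ + κ₄ * radialProfile n r))
      (M' := fun r => b * (κ₄ * (profileSlope n * r ^ (1 - n))))
      (M'' := fun r => b * (κ₄ * (profileSlope n * ((1 - n) * (r ^ (1 - n) / r)))))
      hb hΩ hpos hsmooth.fst hsmooth.snd.fst hsmooth.snd.snd h6 ?_ ?_ ?_ ?_ ?_ ?_ ?_ ?_ ?_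
    · intro r hr
      exact ((((hasDerivAt_id r).const_mul κ₂).add
        ((hasDerivAt_id r).const_mul (κ₃ * (p * b / 2)))).add (hdR r hr)).congr_deriv (by ring)
    · intro r hr
      exact (((hasDerivAt_radialProfile hr).const_mul κ₄).const_add κ₃).const_mul b
    · intro r hr
      exact (((hasDerivAt_rpow_one_sub hr).const_mul (profileSlope n)).const_mul κ₄).const_mul b
    · intro r hr
      field_simp
      ring
    · intro r hr
      linear_combination heR r hr
    · intro hc hp1
      obtain ⟨e3, e4, e6⟩ := hgen hc hp1
      exact ⟨e6, fun r _ => by simp [e3, e4]⟩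
    · intro z hz
      simp only [hX z hz, hZ, X1, X2, X3, X6, Prod.fst_add, Prod.smul_fst, smul_eq_mul]
      ring
    · intro z hz
      simp only [hX z hz, hZ, X1, X2, X3, X6, Prod.fst_add, Prod.snd_add, Prod.smul_fst,
        Prod.smul_snd, smul_eq_mul]
      ring
    · intro z hz
      simp only [hX z hz, hZ, X1, X2, X3, X6, Prod.snd_add, Prod.smul_snd, smul_eq_mul]
      linear_combination (-p * z.1) * hck

end Classification

/-! ### Bases of the symmetry algebra -/

section Bases

variable {a b c p n : ℝ} {Ω : Set Pt}

theorem radialGenerator_fst (z : Pt) : (radialGenerator a b c p n z).1 = 0 := by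
  unfold radialGenerator
  split_ifs <;> rfl

/-- Linear independence of the five generators on an open set; the third and fourth need
`c = 0` or `p = 1`. -/
theorem coefficients_eq_zero (hb : b ≠ 0) (hΩ : IsOpen Ω) (hne : Ω.Nonempty)
    (hpos : ∀ z ∈ Ω, 0 < z.2.1) {κ₁ κ₂ κ₃ κ₄ κ₆ : ℝ}
    (h : ∀ z ∈ Ω, κ₁ • X1 z + κ₂ • X2 z + κ₃ • X3 b c p z + κ₄ • radialGenerator a b c p n z
      + κ₆ • X6 z = 0) :
    (κ₁ = 0 ∧ κ₂ = 0 ∧ κ₆ = 0) ∧ ((1 - p) * c = 0 → κ₃ = 0 ∧ κ₄ = 0) := by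
  obtain ⟨z₀, hz₀⟩ := hne
  have h1 : ∀ z ∈ Ω, κ₁ + κ₂ * z.1 + κ₆ * z.1 ^ 2 = 0 := fun z hz => by
    have := congrArg Prod.fst (h z hz)
    simp only [X1, X2, X3, X6, Prod.fst_add, Prod.smul_fst, smul_eq_mul, radialGenerator_fst,
      Prod.fst_zero] at this
    linear_combination this
  have h2 : ∀ z ∈ Ω, κ₂ + 2 * κ₆ * z.1 = 0 := fun z hz => by
    have := line_t_eq_zero (F := fun z => κ₁ + κ₂ * z.1 + κ₆ * z.1 ^ 2) hΩ h1 hz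
      ((((hasDerivAt_id z.1).const_mul κ₂).const_add κ₁).add
        (((hasDerivAt_id z.1).pow 2).const_mul κ₆))
    simp only [id] at this
    push_cast at this
    linear_combination this
  have h3 : κ₆ = 0 := by
    have := line_t_eq_zero (F := fun z => κ₂ + 2 * κ₆ * z.1) hΩ h2 hz₀
      (((hasDerivAt_id z₀.1).const_mul (2 * κ₆)).const_add κ₂)
    linear_combination this / 2
  have h4 : κ₂ = 0 := by linear_combination h2 z₀ hz₀ - 2 * z₀.1 * h3
  have h5 : κ₁ = 0 := by linear_combination h1 z₀ hz₀ - z₀.1 * h4 - z₀.1 ^ 2 * h3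
  refine ⟨⟨h5, h4, h3⟩, fun hc => ?_⟩
  have h6 : ∀ z ∈ Ω, b * 1 * (κ₃ + κ₄ * radialProfile n z.2.1) = 0 := by
    refine deriv_mul_eq_zero (φ := fun u => b * u + p * c) (φ' := fun _ => b * 1)
      (F := fun z => κ₃ + κ₄ * radialProfile n z.2.1) hΩ
      (fun z _ => ((hasDerivAt_id z.2.2).const_mul b).add_const (p * c)) (fun z hz => ?_)
      fun z hz => ?_
    · exact ((DifferentiableAt.comp (g := radialProfile n) (f := fun z : Pt => z.2.1) z
        (hasDerivAt_radialProfile (hpos z hz)).differentiableAt (by fun_prop)).const_mul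
          κ₄).const_add κ₃
    · have := congrArg (fun y : Pt => y.2.2) (h z hz)
      simp only [X1, X2, X3, X6, Prod.snd_add, Prod.smul_snd, smul_eq_mul,
        radialGenerator_eq z hc, Prod.snd_zero] at this
      linear_combination this - z.1 * z.2.2 * h3
  have h7 : ∀ z ∈ Ω, κ₃ + κ₄ * radialProfile n z.2.1 = 0 := fun z hz => by
    simpa [hb] using h6 z hz
  have h8 := line_r_eq_zero (F := fun z => κ₃ + κ₄ * radialProfile n z.2.1) hΩ h7 hz₀
    (((hasDerivAt_radialProfile (hpos z₀ hz₀)).const_mul κ₄).const_add κ₃)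
  have h9 : κ₄ = 0 := (mul_eq_zero.1 h8).resolve_right
    (mul_ne_zero profileSlope_ne_zero (Real.rpow_pos_of_pos (hpos z₀ hz₀) _).ne')
  exact ⟨by linear_combination h7 z₀ hz₀ - radialProfile n z₀.2.1 * h9, h9⟩

theorem isSymmetryBasis_of_forall {g f : ℝ → ℝ → ℝ → ℝ} {k : ℕ} {v : Fin k → Generator}
    (hind : ∀ κ : Fin k → ℝ, (∀ z ∈ Ω, ∑ i, κ i • v i z = 0) → ∀ i, κ i = 0)
    (hspan : ∀ X : Generator, IsPointSymmetry g f Ω X ↔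
      ∃ κ : Fin k → ℝ, ∀ z ∈ Ω, X z = ∑ i, κ i • v i z) :
    IsSymmetryBasis g f Ω v := by
  refine ⟨Fintype.linearIndependent_iff.2 fun κ h => hind κ fun z hz => ?_, fun X => ?_⟩
  · simpa [Finset.sum_apply] using congrFun h ⟨z, hz⟩
  · rw [hspan]
    simp only [Set.EqOn, Finset.sum_apply, Pi.smul_apply]

theorem isSymmetryBasis_translation_dilation (hn : n ≠ 1) (hp : p ≠ 0) (hb : b ≠ 0) (hΩ : IsOpen Ω)
    (hconn : IsConnected Ω) (hdom : ∀ t r u : ℝ, (t, r, u) ∈ Ω → 0 < r ∧ PowerDomain p u)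
    (hc : c ≠ 0) (hp1 : p ≠ 1) :
    IsSymmetryBasis (gCoeff b c p) (fCoeff a b c p n) Ω
      ![X1, X2] := by
  have hpos : ∀ z ∈ Ω, 0 < z.2.1 := fun z hz => (hdom z.1 z.2.1 z.2.2 hz).1
  refine isSymmetryBasis_of_forall (fun κ h => ?_) fun X => ?_
  · obtain ⟨⟨h1, h2, -⟩, -⟩ := coefficients_eq_zero (a := a) (c := c) (p := p) (n := n)
      (κ₁ := κ 0) (κ₂ := κ 1) (κ₃ := 0) (κ₄ := 0) (κ₆ := 0) hb hΩ hconn.nonempty hpos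
      fun z hz => by simpa [Fin.sum_univ_two] using h z hz
    intro i
    fin_cases i <;> assumption
  · rw [isPointSymmetry_iff_exists hn hp hb hΩ hconn hdom]
    constructor
    · rintro ⟨κ₁, κ₂, κ₃, κ₄, κ₆, -, -, h, hX⟩
      obtain ⟨rfl, rfl, rfl⟩ := h hc hp1
      exact ⟨![κ₁, κ₂], fun z hz => by simpa [Fin.sum_univ_two] using hX z hz⟩
    · rintro ⟨κ, hX⟩
      exact ⟨κ 0, κ 1, 0, 0, 0, by simp, by simp, by simp,
        fun z hz => by simpa [Fin.sum_univ_two] using hX z hz⟩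

theorem isSymmetryBasis_scaling (hn : n ≠ 1) (hp : p ≠ 0) (hb : b ≠ 0) (hΩ : IsOpen Ω)
    (hconn : IsConnected Ω) (hdom : ∀ t r u : ℝ, (t, r, u) ∈ Ω → 0 < r ∧ PowerDomain p u)
    (hc : c = 0 ∨ p = 1)
    (hρ : a * (n - 3) + b * (n - 3 - p * (n - 2) / 2) ≠ 0) (hp4 : p ≠ -4) :
    IsSymmetryBasis (gCoeff b c p) (fCoeff a b c p n) Ω
      ![X1, X2, X3 b c p] := by
  have hpos : ∀ z ∈ Ω, 0 < z.2.1 := fun z hz => (hdom z.1 z.2.1 z.2.2 hz).1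
  have hc' : (1 - p) * c = 0 := by rcases hc with rfl | rfl <;> ring
  refine isSymmetryBasis_of_forall (fun κ h => ?_) fun X => ?_
  · obtain ⟨⟨h1, h2, -⟩, h34⟩ := coefficients_eq_zero (a := a) (c := c) (p := p) (n := n)
      (κ₁ := κ 0) (κ₂ := κ 1) (κ₃ := κ 2) (κ₄ := 0) (κ₆ := 0) hb hΩ hconn.nonempty hpos
      fun z hz => by simpa [Fin.sum_univ_three] using h z hz
    obtain ⟨h3, -⟩ := h34 hc'
    intro i
    fin_cases i <;> assumption
  · rw [isPointSymmetry_iff_exists hn hp hb hΩ hconn hdom]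
    constructor
    · rintro ⟨κ₁, κ₂, κ₃, κ₄, κ₆, h6, h4, -, hX⟩
      obtain rfl : κ₄ = 0 := (mul_eq_zero.1 h4).resolve_left hρ
      obtain rfl : κ₆ = 0 := (mul_eq_zero.1 h6).resolve_left fun h => hp4 (by linarith)
      exact ⟨![κ₁, κ₂, κ₃], fun z hz => by simpa [Fin.sum_univ_three] using hX z hz⟩
    · rintro ⟨κ, hX⟩
      exact ⟨κ 0, κ 1, κ 2, 0, 0, by simp, by simp,
        fun h h' => absurd hc (not_or.2 ⟨h, h'⟩),
        fun z hz => by simpa [Fin.sum_univ_three] using hX z hz⟩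

theorem isSymmetryBasis_radial (hn : n ≠ 1) (hp : p ≠ 0) (hb : b ≠ 0) (hΩ : IsOpen Ω)
    (hconn : IsConnected Ω) (hdom : ∀ t r u : ℝ, (t, r, u) ∈ Ω → 0 < r ∧ PowerDomain p u)
    (hc : c = 0 ∨ p = 1)
    (hρ : a * (n - 3) + b * (n - 3 - p * (n - 2) / 2) = 0) (hp4 : p ≠ -4) :
    IsSymmetryBasis (gCoeff b c p) (fCoeff a b c p n) Ω
      ![X1, X2, X3 b c p, radialGenerator a b c p n] := by
  have hpos : ∀ z ∈ Ω, 0 < z.2.1 := fun z hz => (hdom z.1 z.2.1 z.2.2 hz).1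
  have hc' : (1 - p) * c = 0 := by rcases hc with rfl | rfl <;> ring
  refine isSymmetryBasis_of_forall (fun κ h => ?_) fun X => ?_
  · obtain ⟨⟨h1, h2, -⟩, h34⟩ := coefficients_eq_zero (a := a) (c := c) (p := p) (n := n)
      (κ₁ := κ 0) (κ₂ := κ 1) (κ₃ := κ 2) (κ₄ := κ 3) (κ₆ := 0) hb hΩ hconn.nonempty hpos
      fun z hz => by simpa [Fin.sum_univ_four] using h z hz
    obtain ⟨h3, h4⟩ := h34 hc'
    intro i
    fin_cases i <;> assumption
  · rw [isPointSymmetry_iff_exists hn hp hb hΩ hconn hdom]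
    constructor
    · rintro ⟨κ₁, κ₂, κ₃, κ₄, κ₆, h6, -, -, hX⟩
      obtain rfl : κ₆ = 0 := (mul_eq_zero.1 h6).resolve_left fun h => hp4 (by linarith)
      exact ⟨![κ₁, κ₂, κ₃, κ₄], fun z hz => by simpa [Fin.sum_univ_four] using hX z hz⟩
    · rintro ⟨κ, hX⟩
      exact ⟨κ 0, κ 1, κ 2, κ 3, 0, by simp, by simp [hρ],
        fun h h' => absurd hc (not_or.2 ⟨h, h'⟩),
        fun z hz => by simpa [Fin.sum_univ_four] using hX z hz⟩

theorem isSymmetryBasis_inversion (hn : n ≠ 1) (hp : p ≠ 0) (hb : b ≠ 0) (hΩ : IsOpen Ω)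
    (hconn : IsConnected Ω) (hdom : ∀ t r u : ℝ, (t, r, u) ∈ Ω → 0 < r ∧ PowerDomain p u)
    (hc : c = 0 ∨ p = 1)
    (hρ : a * (n - 3) + b * (n - 3 - p * (n - 2) / 2) ≠ 0) (hp4 : p = -4) :
    IsSymmetryBasis (gCoeff b c p) (fCoeff a b c p n) Ω
      ![X1, X2, X3 b c p, X6] := by
  have hpos : ∀ z ∈ Ω, 0 < z.2.1 := fun z hz => (hdom z.1 z.2.1 z.2.2 hz).1
  have hc' : (1 - p) * c = 0 := by rcases hc with rfl | rfl <;> ring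
  refine isSymmetryBasis_of_forall (fun κ h => ?_) fun X => ?_
  · obtain ⟨⟨h1, h2, h6⟩, h34⟩ := coefficients_eq_zero (a := a) (c := c) (p := p) (n := n)
      (κ₁ := κ 0) (κ₂ := κ 1) (κ₃ := κ 2) (κ₄ := 0) (κ₆ := κ 3) hb hΩ hconn.nonempty hpos
      fun z hz => by simpa [Fin.sum_univ_four] using h z hz
    obtain ⟨h3, -⟩ := h34 hc'
    intro i
    fin_cases i <;> assumption
  · rw [isPointSymmetry_iff_exists hn hp hb hΩ hconn hdom]
    constructor
    · rintro ⟨κ₁, κ₂, κ₃, κ₄, κ₆, -, h4, -, hX⟩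
      obtain rfl : κ₄ = 0 := (mul_eq_zero.1 h4).resolve_left hρ
      exact ⟨![κ₁, κ₂, κ₃, κ₆], fun z hz => by simpa [Fin.sum_univ_four] using hX z hz⟩
    · rintro ⟨κ, hX⟩
      exact ⟨κ 0, κ 1, κ 2, 0, κ 3, by simp [hp4], by simp,
        fun h h' => absurd hc (not_or.2 ⟨h, h'⟩),
        fun z hz => by simpa [Fin.sum_univ_four] using hX z hz⟩

theorem isSymmetryBasis_radial_inversion (hn : n ≠ 1) (hp : p ≠ 0) (hb : b ≠ 0) (hΩ : IsOpen Ω)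
    (hconn : IsConnected Ω) (hdom : ∀ t r u : ℝ, (t, r, u) ∈ Ω → 0 < r ∧ PowerDomain p u)
    (hc : c = 0 ∨ p = 1)
    (hρ : a * (n - 3) + b * (n - 3 - p * (n - 2) / 2) = 0) (hp4 : p = -4) :
    IsSymmetryBasis (gCoeff b c p) (fCoeff a b c p n) Ω
      ![X1, X2, X3 b c p, radialGenerator a b c p n, X6] := by
  have hpos : ∀ z ∈ Ω, 0 < z.2.1 := fun z hz => (hdom z.1 z.2.1 z.2.2 hz).1
  have hc' : (1 - p) * c = 0 := by rcases hc with rfl | rfl <;> ring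
  refine isSymmetryBasis_of_forall (fun κ h => ?_) fun X => ?_
  · obtain ⟨⟨h1, h2, h6⟩, h34⟩ := coefficients_eq_zero (a := a) (c := c) (p := p) (n := n)
      (κ₁ := κ 0) (κ₂ := κ 1) (κ₃ := κ 2) (κ₄ := κ 3) (κ₆ := κ 4) hb hΩ hconn.nonempty hpos
      fun z hz => by simpa [Fin.sum_univ_five] using h z hz
    obtain ⟨h3, h4⟩ := h34 hc'
    intro i
    fin_cases i <;> assumption
  · rw [isPointSymmetry_iff_exists hn hp hb hΩ hconn hdom]
    constructor
    · rintro ⟨κ₁, κ₂, κ₃, κ₄, κ₆, -, -, -, hX⟩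
      exact ⟨![κ₁, κ₂, κ₃, κ₄, κ₆], fun z hz => by simpa [Fin.sum_univ_five] using hX z hz⟩
    · rintro ⟨κ, hX⟩
      exact ⟨κ 0, κ 1, κ 2, κ 3, κ 4, by simp [hp4], by simp [hρ],
        fun h h' => absurd hc (not_or.2 ⟨h, h'⟩),
        fun z hz => by simpa [Fin.sum_univ_five] using hX z hz⟩

end Bases

/-! ### Commutators -/

section Commutators

variable {a b c p n : ℝ} {Ω : Set Pt}

theorem hasDerivAt_add_mul (x w : ℝ) : HasDerivAt (fun s => x + s * w) w 0 := by
  simpa using ((hasDerivAt_id (0 : ℝ)).mul_const w).const_add x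

/-- The derivative of a generator in direction `v`, computed along a line. -/
theorem fderiv_generator_eq {X : Generator} {z v y : Pt} (hX : DifferentiableAt ℝ X z)
    (h : HasDerivAt (fun s => X (z.1 + s * v.1, z.2.1 + s * v.2.1, z.2.2 + s * v.2.2)) y 0) :
    fderiv ℝ X z v = y := by
  have h0 : HasFDerivAt X (fderiv ℝ X z)
      ((z.1 + 0 * v.1, z.2.1 + 0 * v.2.1, z.2.2 + 0 * v.2.2) : Pt) := by
    simpa using hX.hasFDerivAt
  exact (HasFDerivAt.comp_hasDerivAt
    (f := fun s => ((z.1 + s * v.1, z.2.1 + s * v.2.1, z.2.2 + s * v.2.2) : Pt)) 0 h0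
    ((hasDerivAt_add_mul _ _).prodMk
      ((hasDerivAt_add_mul _ _).prodMk (hasDerivAt_add_mul _ _)))).unique h

theorem fderiv_X1 (z v : Pt) : fderiv ℝ X1 z v = 0 := by
  unfold X1
  simp

theorem fderiv_X2 (z v : Pt) : fderiv ℝ X2 z v = (v.1, v.2.1, 0) :=
  fderiv_generator_eq (by unfold X2; fun_prop) ((hasDerivAt_add_mul _ _).prodMk
    ((hasDerivAt_add_mul _ _).prodMk (hasDerivAt_const _ _)))

theorem fderiv_X3 (z v : Pt) : fderiv ℝ (X3 b c p) z v = (0, p * b * v.2.1 / 2, b * v.2.2) :=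
  fderiv_generator_eq (by unfold X3; fun_prop) ((hasDerivAt_const _ _).prodMk
    ((((hasDerivAt_add_mul _ _).const_mul (p * b)).div_const 2).prodMk
      (((hasDerivAt_add_mul _ _).const_mul b).add_const (p * c))))

theorem fderiv_X4 {z : Pt} (hz : 0 < z.2.1) (v : Pt) : fderiv ℝ (X4 a b c p n) z v =
    (0, (a + b + (1 - p) * c) * ((3 - n) * z.2.1 ^ (2 - n) * v.2.1),
      (2 - n) * ((2 - n) * z.2.1 ^ (1 - n) * v.2.1) * ((b + (1 - p) * c) * z.2.2 + p * c)
        + (2 - n) * z.2.1 ^ (2 - n) * ((b + (1 - p) * c) * v.2.2)) := by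
  have hpow : ∀ q : ℝ, HasDerivAt (fun s => (z.2.1 + s * v.2.1) ^ q)
      (q * z.2.1 ^ (q - 1) * v.2.1) 0 := fun q => by
    have h0 : HasDerivAt (fun r : ℝ => r ^ q) (q * z.2.1 ^ (q - 1)) (z.2.1 + 0 * v.2.1) := by
      simpa using Real.hasDerivAt_rpow_const (x := z.2.1) (p := q) (.inl hz.ne')
    exact h0.comp 0 (hasDerivAt_add_mul _ _)
  have hd : DifferentiableAt ℝ (X4 a b c p n) z := ((contDiffOn_X4.differentiableOn
    (by simp)).differentiableAt ((isOpen_lt continuous_const (by fun_prop)).mem_nhds hz))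
  refine fderiv_generator_eq hd (((hasDerivAt_const _ _).prodMk
    (((hpow (3 - n)).const_mul _).prodMk (((hpow (2 - n)).const_mul (2 - n)).mul
      (((hasDerivAt_add_mul _ _).const_mul _).add_const (p * c))))).congr_deriv ?_)
  simp only [zero_mul, add_zero, show 3 - n - 1 = 2 - n by ring, show 2 - n - 1 = 1 - n by ring]

theorem fderiv_X5 {z : Pt} (hz : 0 < z.2.1) (v : Pt) : fderiv ℝ (X5 b c p) z v =
    (0, p * b * (Real.log z.2.1 + 1) * v.2.1 / 2,
      v.2.1 / z.2.1 * (b * z.2.2 + p * c) + (1 + Real.log z.2.1) * (b * v.2.2)) := by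
  have hlog : HasDerivAt (fun s => Real.log (z.2.1 + s * v.2.1)) (v.2.1 / z.2.1) 0 := by
    simpa using (hasDerivAt_add_mul z.2.1 v.2.1).log (by simpa using hz.ne')
  have hd : DifferentiableAt ℝ (X5 b c p) z := ((contDiffOn_X5.differentiableOn
    (by simp)).differentiableAt ((isOpen_lt continuous_const (by fun_prop)).mem_nhds hz))
  refine fderiv_generator_eq hd (((hasDerivAt_const _ _).prodMk
    (((((hasDerivAt_add_mul _ _).const_mul (p * b)).mul hlog).div_const 2).prodMk
      ((hlog.const_add 1).mul
      (((hasDerivAt_add_mul _ _).const_mul b).add_const (p * c))))).congr_deriv ?_)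
  simp only [zero_mul, add_zero]
  refine Prod.ext rfl (Prod.ext ?_ rfl)
  field_simp

theorem fderiv_X6 (z v : Pt) : fderiv ℝ X6 z v = (2 * z.1 * v.1, 0, v.1 * z.2.2 + z.1 * v.2.2) := by
  refine fderiv_generator_eq (by unfold X6; fun_prop) ((((hasDerivAt_add_mul _ _).pow 2).prodMk
    ((hasDerivAt_const _ _).prodMk
      ((hasDerivAt_add_mul _ _).mul (hasDerivAt_add_mul _ _)))).congr_deriv ?_)
  simp

theorem hasCommutator_X1_X2 : HasCommutator Ω X1 X2 X1 := fun z _ => by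
  simp [VectorField.lieBracket, fderiv_X1, fderiv_X2, X1]

theorem hasCommutator_X1_X3 : HasCommutator Ω X1 (X3 b c p) 0 := fun z _ => by
  simp [VectorField.lieBracket, fderiv_X1, fderiv_X3, X1]

theorem hasCommutator_X2_X3 : HasCommutator Ω X2 (X3 b c p) 0 := fun z _ => by
  simp [VectorField.lieBracket, fderiv_X2, fderiv_X3, X2, X3]

theorem hasCommutator_X1_X4 (hpos : ∀ z ∈ Ω, 0 < z.2.1) : HasCommutator Ω X1 (X4 a b c p n) 0 :=
  fun z hz => by simp [VectorField.lieBracket, fderiv_X1, fderiv_X4 (hpos z hz), X1, Prod.ext_iff]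

theorem hasCommutator_X2_X4 (hpos : ∀ z ∈ Ω, 0 < z.2.1) :
    HasCommutator Ω X2 (X4 a b c p n) ((2 - n) • X4 a b c p n) := fun z hz => by
  have hr := hpos z hz
  simp only [VectorField.lieBracket, fderiv_X2, fderiv_X4 hr, X2, X4, Pi.smul_apply,
    rpow_two_sub hr, rpow_three_sub hr]
  refine Prod.ext ?_ (Prod.ext ?_ ?_) <;>
    simp only [Prod.fst_sub, Prod.snd_sub, Prod.smul_fst, Prod.smul_snd, smul_eq_mul] <;> ring

theorem hasCommutator_X3_X4 (hpos : ∀ z ∈ Ω, 0 < z.2.1) (hc : (1 - p) * c = 0) :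
    HasCommutator Ω (X3 b c p) (X4 a b c p n) ((p * (1 - n / 2) * b) • X4 a b c p n) :=
  fun z hz => by
  have hr := hpos z hz
  simp only [VectorField.lieBracket, fderiv_X3, fderiv_X4 hr, X3, X4, Pi.smul_apply,
    rpow_two_sub hr, rpow_three_sub hr, hc]
  refine Prod.ext ?_ (Prod.ext ?_ ?_) <;>
    simp only [Prod.fst_sub, Prod.snd_sub, Prod.smul_fst, Prod.smul_snd, smul_eq_mul] <;> ring

theorem hasCommutator_X1_X5 (hpos : ∀ z ∈ Ω, 0 < z.2.1) : HasCommutator Ω X1 (X5 b c p) 0 :=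
  fun z hz => by simp [VectorField.lieBracket, fderiv_X1, fderiv_X5 (hpos z hz), X1, Prod.ext_iff]

theorem hasCommutator_X2_X5 (hpos : ∀ z ∈ Ω, 0 < z.2.1) :
    HasCommutator Ω X2 (X5 b c p) (X3 b c p) := fun z hz => by
  have hr := hpos z hz
  simp only [VectorField.lieBracket, fderiv_X2, fderiv_X5 hr, X2, X3, X5]
  refine Prod.ext ?_ (Prod.ext ?_ ?_) <;>
    simp only [Prod.fst_sub, Prod.snd_sub] <;> field_simp <;> ring

theorem hasCommutator_X3_X5 (hpos : ∀ z ∈ Ω, 0 < z.2.1) :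
    HasCommutator Ω (X3 b c p) (X5 b c p) ((p * b / 2) • X3 b c p) := fun z hz => by
  have hr := hpos z hz
  simp only [VectorField.lieBracket, fderiv_X3, fderiv_X5 hr, X3, X5, Pi.smul_apply]
  refine Prod.ext ?_ (Prod.ext ?_ ?_) <;>
    simp only [Prod.fst_sub, Prod.snd_sub, Prod.smul_fst, Prod.smul_snd, smul_eq_mul] <;>
    field_simp <;> ring

theorem hasCommutator_X1_X6 (hb : b ≠ 0) :
    HasCommutator Ω X1 X6 ((2 : ℝ) • X2 + (1 / b) • X3 b 0 (-4)) := fun z _ => by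
  simp only [VectorField.lieBracket, fderiv_X1, fderiv_X6, X1, X2, X3, Pi.smul_apply, Pi.add_apply]
  refine Prod.ext ?_ (Prod.ext ?_ ?_) <;>
    simp only [Prod.fst_sub, Prod.snd_sub, Prod.fst_add, Prod.snd_add, Prod.smul_fst,
      Prod.smul_snd, smul_eq_mul, Prod.fst_zero, Prod.snd_zero] <;> field_simp <;> ring

theorem hasCommutator_X2_X6 : HasCommutator Ω X2 X6 X6 := fun z _ => by
  simp only [VectorField.lieBracket, fderiv_X2, fderiv_X6, X2, X6]
  refine Prod.ext ?_ (Prod.ext ?_ ?_) <;> simp only [Prod.fst_sub, Prod.snd_sub] <;> ring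

theorem hasCommutator_X3_X6 : HasCommutator Ω (X3 b 0 p) X6 0 := fun z _ => by
  simp only [VectorField.lieBracket, fderiv_X3, fderiv_X6, X3, X6]
  refine Prod.ext ?_ (Prod.ext ?_ ?_) <;>
    simp only [Prod.fst_sub, Prod.snd_sub, Pi.zero_apply, Prod.fst_zero, Prod.snd_zero] <;> ring

theorem hasCommutator_X4_X6 (hpos : ∀ z ∈ Ω, 0 < z.2.1) :
    HasCommutator Ω (X4 a b 0 p n) X6 0 := fun z hz => by
  simp only [VectorField.lieBracket, fderiv_X4 (hpos z hz), fderiv_X6, X4, X6]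
  refine Prod.ext ?_ (Prod.ext ?_ ?_) <;>
    simp only [Prod.fst_sub, Prod.snd_sub, Pi.zero_apply, Prod.fst_zero, Prod.snd_zero] <;> ring

theorem hasCommutator_X5_X6 (hpos : ∀ z ∈ Ω, 0 < z.2.1) :
    HasCommutator Ω (X5 b 0 p) X6 0 := fun z hz => by
  simp only [VectorField.lieBracket, fderiv_X5 (hpos z hz), fderiv_X6, X5, X6]
  refine Prod.ext ?_ (Prod.ext ?_ ?_) <;>
    simp only [Prod.fst_sub, Prod.snd_sub, Pi.zero_apply, Prod.fst_zero, Prod.snd_zero] <;> ring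

end Commutators

end RadialWave

end

theorem theorem1 (a b c p n : ℝ) (hn : n ≠ 1) (hp : p ≠ 0) (hb : b ≠ 0)
    (Ω : Set Pt) (hΩ : IsOpen Ω) (hconn : IsConnected Ω)
    (hdom : ∀ t r u : ℝ, (t, r, u) ∈ Ω → 0 < r ∧ PowerDomain p u) :
    -- the general case
    (c ≠ 0 → p ≠ 1 →
      IsSymmetryBasis (gCoeff b c p) (fCoeff a b c p n) Ω ![X1, X2] ∧
        HasCommutator Ω X1 X2 X1) ∧
    -- case (i)
    (c = 0 →
      (a * (n - 3) + b * (n - 3 - p * (n - 2) / 2) ≠ 0 → p ≠ -4 →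
        IsSymmetryBasis (gCoeff b c p) (fCoeff a b c p n) Ω ![X1, X2, X3 b c p] ∧
        HasCommutator Ω X1 X2 X1 ∧
        HasCommutator Ω X1 (X3 b c p) 0 ∧
        HasCommutator Ω X2 (X3 b c p) 0) ∧
      (n ≠ 2 → a * (n - 3) + b * (n - 3 - p * (n - 2) / 2) = 0 → p ≠ -4 →
        IsSymmetryBasis (gCoeff b c p) (fCoeff a b c p n) Ω ![X1, X2, X3 b c p, X4 a b c p n] ∧
        HasCommutator Ω X1 X2 X1 ∧
        HasCommutator Ω X1 (X3 b c p) 0 ∧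
        HasCommutator Ω X2 (X3 b c p) 0 ∧
        HasCommutator Ω X1 (X4 a b c p n) 0 ∧
        HasCommutator Ω X2 (X4 a b c p n) ((2 - n) • (X4 a b c p n)) ∧
        HasCommutator Ω (X3 b c p) (X4 a b c p n) ((p * (1 - n / 2) * b) • (X4 a b c p n))) ∧
      (n = 2 → a + b = 0 → p ≠ -4 →
        IsSymmetryBasis (gCoeff b c p) (fCoeff a b c p n) Ω ![X1, X2, X3 b c p, X5 b c p] ∧
        HasCommutator Ω X1 X2 X1 ∧
        HasCommutator Ω X1 (X3 b c p) 0 ∧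
        HasCommutator Ω X2 (X3 b c p) 0 ∧
        HasCommutator Ω X1 (X5 b c p) 0 ∧
        HasCommutator Ω X2 (X5 b c p) (X3 b c p) ∧
        HasCommutator Ω (X3 b c p) (X5 b c p) ((p * b / 2) • (X3 b c p))) ∧
      (a * (n - 3) + b * (n - 3 - p * (n - 2) / 2) ≠ 0 → p = -4 →
        IsSymmetryBasis (gCoeff b c p) (fCoeff a b c p n) Ω ![X1, X2, X3 b c p, X6] ∧
        HasCommutator Ω X1 X2 X1 ∧
        HasCommutator Ω X1 (X3 b c p) 0 ∧
        HasCommutator Ω X2 (X3 b c p) 0 ∧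
        HasCommutator Ω X1 X6 ((2 : ℝ) • X2 + (1 / b) • (X3 b c p)) ∧
        HasCommutator Ω X2 X6 X6 ∧
        HasCommutator Ω (X3 b c p) X6 0) ∧
      (n ≠ 2 → a * (n - 3) + b * (n - 3 - p * (n - 2) / 2) = 0 → p = -4 →
        IsSymmetryBasis (gCoeff b c p) (fCoeff a b c p n) Ω ![X1, X2, X3 b c p, X4 a b c p n, X6] ∧
        HasCommutator Ω X1 X2 X1 ∧
        HasCommutator Ω X1 (X3 b c p) 0 ∧
        HasCommutator Ω X2 (X3 b c p) 0 ∧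
        HasCommutator Ω X1 X6 ((2 : ℝ) • X2 + (1 / b) • (X3 b c p)) ∧
        HasCommutator Ω X2 X6 X6 ∧
        HasCommutator Ω (X3 b c p) X6 0 ∧
        HasCommutator Ω X1 (X4 a b c p n) 0 ∧
        HasCommutator Ω (X4 a b c p n) X6 0 ∧
        HasCommutator Ω X2 (X4 a b c p n) ((2 - n) • (X4 a b c p n)) ∧
        HasCommutator Ω (X3 b c p) (X4 a b c p n) ((2 * (n - 2) * b) • (X4 a b c p n))) ∧
      (n = 2 → a + b = 0 → p = -4 →
        IsSymmetryBasis (gCoeff b c p) (fCoeff a b c p n) Ω ![X1, X2, X3 b c p, X5 b c p, X6] ∧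
        HasCommutator Ω X1 X2 X1 ∧
        HasCommutator Ω X1 (X3 b c p) 0 ∧
        HasCommutator Ω X2 (X3 b c p) 0 ∧
        HasCommutator Ω X1 X6 ((2 : ℝ) • X2 + (1 / b) • (X3 b c p)) ∧
        HasCommutator Ω X2 X6 X6 ∧
        HasCommutator Ω (X3 b c p) X6 0 ∧
        HasCommutator Ω X1 (X5 b c p) 0 ∧
        HasCommutator Ω (X5 b c p) X6 0 ∧
        HasCommutator Ω X2 (X5 b c p) (X3 b c p) ∧
        HasCommutator Ω (X3 b c p) (X5 b c p) ((-2 * b) • (X3 b c p)))) ∧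
    -- case (ii)
    (c ≠ 0 → p = 1 →
      (a * (n - 3) + b * (n - 3 - (n - 2) / 2) ≠ 0 →
        IsSymmetryBasis (gCoeff b c p) (fCoeff a b c p n) Ω ![X1, X2, X3 b c p] ∧
        HasCommutator Ω X1 X2 X1 ∧
        HasCommutator Ω X1 (X3 b c p) 0 ∧
        HasCommutator Ω X2 (X3 b c p) 0) ∧
      (n ≠ 2 → a * (n - 3) + b * (n - 3 - (n - 2) / 2) = 0 →
        IsSymmetryBasis (gCoeff b c p) (fCoeff a b c p n) Ω ![X1, X2, X3 b c p, X4 a b c p n] ∧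
        HasCommutator Ω X1 X2 X1 ∧
        HasCommutator Ω X1 (X3 b c p) 0 ∧
        HasCommutator Ω X2 (X3 b c p) 0 ∧
        HasCommutator Ω X1 (X4 a b c p n) 0 ∧
        HasCommutator Ω X2 (X4 a b c p n) ((2 - n) • (X4 a b c p n)) ∧
        HasCommutator Ω (X3 b c p) (X4 a b c p n) (((1 - n / 2) * b) • (X4 a b c p n))) ∧
      (n = 2 → a + b = 0 →
        IsSymmetryBasis (gCoeff b c p) (fCoeff a b c p n) Ω ![X1, X2, X3 b c p, X5 b c p] ∧
        HasCommutator Ω X1 X2 X1 ∧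
        HasCommutator Ω X1 (X3 b c p) 0 ∧
        HasCommutator Ω X2 (X3 b c p) 0 ∧
        HasCommutator Ω X1 (X5 b c p) 0 ∧
        HasCommutator Ω X2 (X5 b c p) (X3 b c p) ∧
        HasCommutator Ω (X3 b c p) (X5 b c p) ((b / 2) • (X3 b c p)))) := by
  have hpos : ∀ z ∈ Ω, 0 < z.2.1 := fun z hz => (hdom z.1 z.2.1 z.2.2 hz).1
  have hZ4 : n ≠ 2 → X4 a b c p n = radialGenerator a b c p n := fun h => (if_neg h).symm
  have hZ5 : n = 2 → X5 b c p = radialGenerator a b c p n := fun h => (if_pos h).symm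
  -- For `n = 2` the condition `ρ = 0` reads `a + b = 0`.
  have hρ2 : n = 2 → a + b = 0 → a * (n - 3) + b * (n - 3 - p * (n - 2) / 2) = 0 := by
    rintro rfl h
    linear_combination -h
  refine ⟨fun hc hp1 => ⟨isSymmetryBasis_translation_dilation hn hp hb hΩ hconn hdom hc hp1,
    hasCommutator_X1_X2⟩, ?_, ?_⟩
  · rintro rfl
    have hc : (0 : ℝ) = 0 ∨ p = 1 := .inl rfl
    refine ⟨fun hρ hp4 => ⟨?_, hasCommutator_X1_X2, hasCommutator_X1_X3, hasCommutator_X2_X3⟩,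
      fun hn2 hρ hp4 => ⟨?_, hasCommutator_X1_X2, hasCommutator_X1_X3, hasCommutator_X2_X3,
        hasCommutator_X1_X4 hpos, hasCommutator_X2_X4 hpos, hasCommutator_X3_X4 hpos (by ring)⟩,
      fun hn2 hab hp4 => ⟨?_, hasCommutator_X1_X2, hasCommutator_X1_X3, hasCommutator_X2_X3,
        hasCommutator_X1_X5 hpos, hasCommutator_X2_X5 hpos, hasCommutator_X3_X5 hpos⟩,
      fun hρ hp4 => ⟨?_, hasCommutator_X1_X2, hasCommutator_X1_X3, hasCommutator_X2_X3, ?_,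
        hasCommutator_X2_X6, hasCommutator_X3_X6⟩,
      fun hn2 hρ hp4 => ⟨?_, hasCommutator_X1_X2, hasCommutator_X1_X3, hasCommutator_X2_X3, ?_,
        hasCommutator_X2_X6, hasCommutator_X3_X6, hasCommutator_X1_X4 hpos,
        hasCommutator_X4_X6 hpos, hasCommutator_X2_X4 hpos, ?_⟩,
      fun hn2 hab hp4 => ⟨?_, hasCommutator_X1_X2, hasCommutator_X1_X3, hasCommutator_X2_X3, ?_,
        hasCommutator_X2_X6, hasCommutator_X3_X6, hasCommutator_X1_X5 hpos,
        hasCommutator_X5_X6 hpos, hasCommutator_X2_X5 hpos, ?_⟩⟩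
    · exact isSymmetryBasis_scaling hn hp hb hΩ hconn hdom hc hρ hp4
    · rw [hZ4 hn2]
      exact isSymmetryBasis_radial hn hp hb hΩ hconn hdom hc hρ hp4
    · rw [hZ5 hn2]
      exact isSymmetryBasis_radial hn hp hb hΩ hconn hdom hc (hρ2 hn2 hab) hp4
    · exact isSymmetryBasis_inversion hn hp hb hΩ hconn hdom hc hρ hp4
    · subst hp4
      exact hasCommutator_X1_X6 hb
    · rw [hZ4 hn2]
      exact isSymmetryBasis_radial_inversion hn hp hb hΩ hconn hdom hc hρ hp4
    · subst hp4
      exact hasCommutator_X1_X6 hb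
    · rw [show 2 * (n - 2) * b = p * (1 - n / 2) * b by rw [hp4]; ring]
      exact hasCommutator_X3_X4 hpos (by ring)
    · rw [hZ5 hn2]
      exact isSymmetryBasis_radial_inversion hn hp hb hΩ hconn hdom hc (hρ2 hn2 hab) hp4
    · subst hp4
      exact hasCommutator_X1_X6 hb
    · rw [show -2 * b = p * b / 2 by rw [hp4]; ring]
      exact hasCommutator_X3_X5 hpos
  · rintro - rfl
    have hc : c = 0 ∨ (1 : ℝ) = 1 := .inr rfl
    have hp4 : (1 : ℝ) ≠ -4 := by norm_num
    refine ⟨fun hρ => ⟨?_, hasCommutator_X1_X2, hasCommutator_X1_X3, hasCommutator_X2_X3⟩,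
      fun hn2 hρ => ⟨?_, hasCommutator_X1_X2, hasCommutator_X1_X3, hasCommutator_X2_X3,
        hasCommutator_X1_X4 hpos, hasCommutator_X2_X4 hpos, ?_⟩,
      fun hn2 hab => ⟨?_, hasCommutator_X1_X2, hasCommutator_X1_X3, hasCommutator_X2_X3,
        hasCommutator_X1_X5 hpos, hasCommutator_X2_X5 hpos, ?_⟩⟩
    · exact isSymmetryBasis_scaling hn hp hb hΩ hconn hdom hc (by rwa [one_mul]) hp4
    · rw [hZ4 hn2]
      exact isSymmetryBasis_radial hn hp hb hΩ hconn hdom hc (by rwa [one_mul]) hp4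
    · rw [show (1 - n / 2) * b = 1 * (1 - n / 2) * b by ring]
      exact hasCommutator_X3_X4 hpos (by ring)
    · rw [hZ5 hn2]
      exact isSymmetryBasis_radial hn hp hb hΩ hconn hdom hc (hρ2 hn2 hab) hp4
    · rw [show b / 2 = 1 * b / 2 by ring]
      exact hasCommutator_X3_X5 hpos
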